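/- Let $\mathcal H$ be the Hilbert space of one bosonic mode, with number basis $|n\rangle$, annihilation operator $a$ and quadratures $\hat q=a+a^\dagger$, $\hat p=i(a^\dagger-a)$; for $x\in\mathbb C$ let $|x\rangle=e^{-|x|^2/2}\sum_{k\ge 0}\frac{x^k}{\sqrt{k!}}|k\rangle$ be the coherent state. For a complex random variable $X$ with finite alphabet $\mathcal X$ put $\rho_X=\sum_{x\in\mathcal X}\Pr[X=x]\,|x\rangle\langle x|$. A density operator $\tau$ with finite mean photon number $\operatorname{tr}(a^\dagger a\,\tau)$, displacement vector $\bar r$ and covariance matrix $\Gamma$ (of the quadratures $\hat r=(\hat q,\hat p)$) is Gaussian if $\operatorname{tr}(D(r)\tau)=\exp\big(i\,\bar r^{T}\Omega r-\tfrac12(\Omega r)^{T}\Gamma\,\Omega r\big)$ for all $r\in\mathbb R^2$, where $\Omega=\begin{pmatrix}0&1\\-1&0\end{pmatrix}$ and $D(r)=e^{i\hat r^{T}\Omega r}$. For a density operator $\rho$ with finite mean photon number, $\rho^G$ denotes the Gaussian state with the same displacement vector and covariance matrix as $\rho$. Let $S(\rho)=-\operatorname{tr}(\rho\log\rho)$,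 let $S(\rho\|\sigma)=\operatorname{tr}[\rho(\log\rho-\log\sigma)]\in[0,\infty]$ be the quantum relative entropy, and let $\delta_{vN}(\rho)=S(\rho\|\rho^G)$. Let $V_m>0$ and let $X_G\sim\mathbb C\mathcal N(0,V_m)$ be circularly symmetric complex Gaussian (independent real and imaginary parts, each of law $\mathcal N(0,V_m/2)$). Let $(X_n)_{n\in\mathbb N}$ be complex random variables with finite alphabets and with the same first and second moments as $X_G$, that is, $\mathbb E X_n=0$, $\mathbb E|X_n|^2=V_m$ and $\mathbb E X_n^2=0$ for all $n$. If $X_n\to X_G$ in distribution, then for every $n$ the Gaussian equivalent $\rho_{X_n}^G$ exists and is unique, $S(\rho_{X_n}^G)<\infty$ and $\delta_{vN}(\rho_{X_n})=S(\rho_{X_n}^G)-S(\rho_{X_n})$, and $$\lim_{n\to\infty}\delta_{vN}(\rho_{X_n})=0 .$$ -/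

import Mathlib

open MeasureTheory Filter Topology
open scoped ENNReal NNReal InnerProductSpace

noncomputable section

namespace CVQKD

/-! ### One bosonic mode: a Hilbert space `H` with number (Fock) basis `|n⟩ = b n`, `n = 0, 1, 2, …` -/

/-- The amplitudes `⟨n|ψ⟩` of a vector in the number (Fock) basis `|n⟩ = b n`. -/
def amplitudes {H : Type*} [NormedAddCommGroup H] [InnerProductSpace ℂ H]
    (b : HilbertBasis ℕ ℂ H) (ψ : H) : ℕ → ℂ :=
  fun n => inner ℂ (b n) ψ

/-- The annihilation operator on amplitude sequences: `a|n⟩ = √n |n-1⟩`, `a|0⟩ = 0`. -/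
def annihilation : (ℕ → ℂ) →ₗ[ℂ] (ℕ → ℂ) where
  toFun ψ n := (√((n : ℝ) + 1) : ℂ) * ψ (n + 1)
  map_add' ψ φ := by ext n; simp [mul_add]
  map_smul' c ψ := by ext n; simp [mul_left_comm]

/-- The creation operator on amplitude sequences: `a†|n⟩ = √(n+1) |n+1⟩`
(the truncated index `n - 1` at `n = 0` carries the coefficient `√0 = 0`). -/
def creation : (ℕ → ℂ) →ₗ[ℂ] (ℕ → ℂ) where
  toFun ψ n := (√(n : ℝ) : ℂ) * ψ (n - 1)
  map_add' ψ φ := by ext n; simp [mul_add]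
  map_smul' c ψ := by ext n; simp [mul_left_comm]

/-- The number operator `a†a`. -/
def number : Module.End ℂ (ℕ → ℂ) := creation * annihilation

/-- The quadratures `r = (q, p)` with `q = a + a†` and `p = i(a† - a)`, so `[q, p] = 2i`. -/
def quadrature : Fin 2 → Module.End ℂ (ℕ → ℂ) :=
  ![annihilation + creation, Complex.I • (creation - annihilation)]

/-- The coherent-state amplitudes are square-summable, with total weight one. -/
theorem hasSum_coherent_sq (α : ℂ) :
    HasSum (fun n : ℕ =>
      ‖(Real.exp (-‖α‖ ^ 2 / 2) : ℂ) * (α ^ n / (√(n.factorial : ℝ) : ℂ))‖ ^ 2) 1 := by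
  have h := (NormedSpace.expSeries_div_hasSum_exp (‖α‖ ^ 2)).mul_left (Real.exp (-‖α‖ ^ 2))
  rw [← Real.exp_eq_exp_ℝ, ← Real.exp_add, neg_add_cancel, Real.exp_zero] at h
  refine h.congr_fun ?_
  intro n
  have h1 : Real.exp (-‖α‖ ^ 2 / 2) ^ 2 = Real.exp (-‖α‖ ^ 2) := by
    rw [← Real.exp_nat_mul]; congr 1; push_cast; ring
  rw [norm_mul, norm_div, norm_pow, Complex.norm_real, Complex.norm_real, Real.norm_eq_abs,
    Real.norm_eq_abs, Real.abs_exp, abs_of_nonneg (Real.sqrt_nonneg _), mul_pow, div_pow, h1,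
    Real.sq_sqrt (by positivity)]
  ring

/-- The amplitudes `e^{-|α|²/2} αⁿ/√(n!)` of a coherent state. -/
def coherentSeq (α : ℂ) : lp (fun _ : ℕ => ℂ) 2 :=
  ⟨fun n => (Real.exp (-‖α‖ ^ 2 / 2) : ℂ) * (α ^ n / (√(n.factorial : ℝ) : ℂ)),
    memℓp_gen (by simpa using (hasSum_coherent_sq α).summable)⟩

theorem coherentSeq_apply (α : ℂ) (n : ℕ) :
    coherentSeq α n =
      (Real.exp (-‖α‖ ^ 2 / 2) : ℂ) * (α ^ n / (√(n.factorial : ℝ) : ℂ)) := rfl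

theorem sqrt_factorial_sq (n : ℕ) :
    (√(n.factorial : ℝ) : ℂ) * (√(n.factorial : ℝ) : ℂ) = (n.factorial : ℂ) := by
  rw [← Complex.ofReal_mul, Real.mul_self_sqrt (by positivity)]; simp

/-- `⟨β|γ⟩ = exp(-|β|²/2 - |γ|²/2 + β̄γ)`. -/
theorem inner_coherentSeq (β γ : ℂ) :
    inner ℂ (coherentSeq β) (coherentSeq γ) =
      Complex.exp (-(‖β‖ : ℂ) ^ 2 / 2 - (‖γ‖ : ℂ) ^ 2 / 2 + starRingEnd ℂ β * γ) := by
  have h := (NormedSpace.expSeries_div_hasSum_exp (starRingEnd ℂ β * γ)).mul_left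
    (Complex.exp (-(‖β‖ : ℂ) ^ 2 / 2 - (‖γ‖ : ℂ) ^ 2 / 2))
  rw [← Complex.exp_eq_exp_ℂ, ← Complex.exp_add] at h
  refine (lp.hasSum_inner (coherentSeq β) (coherentSeq γ)).unique (h.congr_fun ?_)
  intro n
  have hn := sqrt_factorial_sq n
  have hn0 : (√(n.factorial : ℝ) : ℂ) ≠ 0 := by
    intro h0
    rw [h0, zero_mul] at hn
    exact Nat.cast_ne_zero.mpr n.factorial_ne_zero hn.symm
  rw [coherentSeq_apply, coherentSeq_apply, sub_eq_add_neg, Complex.exp_add, ← hn]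
  simp only [RCLike.inner_apply, map_mul, map_div₀, map_pow, Complex.conj_ofReal, mul_pow]
  push_cast
  have e : -((‖γ‖ : ℂ) ^ 2 / 2) = -(‖γ‖ : ℂ) ^ 2 / 2 := by ring
  rw [e]
  field_simp

section Hilbert

variable {H : Type*} [NormedAddCommGroup H] [InnerProductSpace ℂ H]

/-- The coherent state `|α⟩ = e^{-|α|²/2} ∑ₙ αⁿ/√(n!) |n⟩`. -/
def coherent (b : HilbertBasis ℕ ℂ H) (α : ℂ) : H := b.repr.symm (coherentSeq α)

theorem inner_coherent (b : HilbertBasis ℕ ℂ H) (β γ : ℂ) :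
    inner ℂ (coherent b β) (coherent b γ) =
      Complex.exp (-(‖β‖ : ℂ) ^ 2 / 2 - (‖γ‖ : ℂ) ^ 2 / 2 + starRingEnd ℂ β * γ) := by
  rw [coherent, coherent, LinearIsometryEquiv.inner_map_map, inner_coherentSeq]

theorem norm_coherent (b : HilbertBasis ℕ ℂ H) (α : ℂ) : ‖coherent b α‖ = 1 := by
  have h := inner_self_eq_norm_sq_to_K (𝕜 := ℂ) (coherent b α)
  rw [inner_coherent, Complex.conj_mul'] at h
  have e : -(‖α‖ : ℂ) ^ 2 / 2 - (‖α‖ : ℂ) ^ 2 / 2 + (‖α‖ : ℂ) ^ 2 = 0 := by ring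
  rw [e, Complex.exp_zero] at h
  have h2 : ‖coherent b α‖ ^ 2 = 1 := by
    apply Complex.ofReal_injective
    push_cast
    exact h.symm
  nlinarith [norm_nonneg (coherent b α)]

/-- Finite linear combinations of coherent states, as a map from coefficient families. -/
def coherentComb (b : HilbertBasis ℕ ℂ H) : (ℂ →₀ ℂ) →ₗ[ℂ] H :=
  Finsupp.linearCombination ℂ (coherent b)

/-- The map `|β⟩ ↦ e^{(zβ̄ - z̄β)/2} |z + β⟩` on coefficient families. -/
def displacedComb (b : HilbertBasis ℕ ℂ H) (z : ℂ) : (ℂ →₀ ℂ) →ₗ[ℂ] H :=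
  Finsupp.linearCombination ℂ fun β =>
    Complex.exp ((z * starRingEnd ℂ β - starRingEnd ℂ z * β) / 2) • coherent b (z + β)

theorem eq_zero_of_inner_coherentSeq {ψ : lp (fun _ : ℕ => ℂ) 2}
    (h : ∀ β, inner ℂ (coherentSeq β) ψ = 0) : ψ = 0 := by
  have key : ∀ z : ℂ, HasSum (fun n : ℕ => z ^ n • (ψ n / (√(n.factorial : ℝ) : ℂ))) 0 := by
    intro z
    have h1 := lp.hasSum_inner (𝕜 := ℂ) (coherentSeq (starRingEnd ℂ z)) ψ
    rw [h (starRingEnd ℂ z)] at h1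
    have h2 := h1.mul_left (Real.exp (-‖z‖ ^ 2 / 2) : ℂ)⁻¹
    rw [mul_zero] at h2
    refine h2.congr_fun ?_
    intro n
    have hne : (Real.exp (-‖z‖ ^ 2 / 2) : ℂ) ≠ 0 := by
      exact_mod_cast (Real.exp_pos _).ne'
    rw [coherentSeq_apply]
    simp only [RCLike.inner_apply, map_mul, map_div₀, map_pow, Complex.conj_ofReal,
      RCLike.norm_conj, Complex.conj_conj, smul_eq_mul]
    field_simp
  have hp : HasFPowerSeriesAt (0 : ℂ → ℂ)
      (FormalMultilinearSeries.ofScalars ℂ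
        (fun n : ℕ => ψ n / (√(n.factorial : ℝ) : ℂ))) 0 := by
    rw [hasFPowerSeriesAt_iff]
    refine Filter.Eventually.of_forall fun z => ?_
    simpa [FormalMultilinearSeries.coeff_ofScalars] using key z
  have h0 := hp.eq_zero
  ext n
  have h3 : (FormalMultilinearSeries.ofScalars ℂ
      (fun n : ℕ => ψ n / (√(n.factorial : ℝ) : ℂ))).coeff n = (0 : ℂ) := by
    rw [h0]; rfl
  rw [FormalMultilinearSeries.coeff_ofScalars, div_eq_zero_iff] at h3
  rcases h3 with h3 | h3
  · simpa using h3
  · exfalso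
    have hn := sqrt_factorial_sq n
    rw [h3, zero_mul] at hn
    exact Nat.cast_ne_zero.mpr n.factorial_ne_zero hn.symm

theorem eq_zero_of_inner_coherent (b : HilbertBasis ℕ ℂ H) {ψ : H}
    (h : ∀ β, inner ℂ (coherent b β) ψ = 0) : ψ = 0 := by
  have h1 : b.repr ψ = 0 := by
    refine eq_zero_of_inner_coherentSeq fun β => ?_
    rw [← h β, coherent, ← b.repr.inner_map_map, LinearIsometryEquiv.apply_symm_apply]
  simpa using h1

theorem norm_displacedComb (b : HilbertBasis ℕ ℂ H) (z : ℂ) (c : ℂ →₀ ℂ) :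
    ‖displacedComb b z c‖ = ‖coherentComb b c‖ := by
  have hg : ∀ γ β : ℂ,
      inner ℂ (Complex.exp ((z * starRingEnd ℂ γ - starRingEnd ℂ z * γ) / 2) • coherent b (z + γ))
        (Complex.exp ((z * starRingEnd ℂ β - starRingEnd ℂ z * β) / 2) • coherent b (z + β)) =
      inner ℂ (coherent b γ) (coherent b β) := by
    intro γ β
    rw [inner_smul_left, inner_smul_right, inner_coherent, inner_coherent, ← Complex.exp_conj,
      ← Complex.exp_add, ← Complex.exp_add]
    congr 1
    simp only [← Complex.conj_mul', map_add, map_sub, map_mul, map_div₀, Complex.conj_conj,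
      map_ofNat]
    ring
  have hi : inner ℂ (displacedComb b z c) (displacedComb b z c) =
      inner ℂ (coherentComb b c) (coherentComb b c) := by
    simp only [displacedComb, coherentComb, Finsupp.linearCombination_apply, Finsupp.sum,
      sum_inner, inner_sum]
    refine Finset.sum_congr rfl fun γ _ => Finset.sum_congr rfl fun β _ => ?_
    rw [inner_smul_left, inner_smul_right, hg, inner_smul_left, inner_smul_right]
  have h2 : ‖displacedComb b z c‖ ^ 2 = ‖coherentComb b c‖ ^ 2 := by
    rw [inner_self_eq_norm_sq_to_K, inner_self_eq_norm_sq_to_K] at hi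
    exact_mod_cast hi
  exact (sq_eq_sq₀ (norm_nonneg _) (norm_nonneg _)).mp h2

variable [CompleteSpace H]

theorem denseRange_coherentComb (b : HilbertBasis ℕ ℂ H) : DenseRange (coherentComb b) := by
  have hd : Dense ((LinearMap.range (coherentComb b) : Submodule ℂ H) : Set H) := by
    rw [Submodule.dense_iff_topologicalClosure_eq_top, Submodule.topologicalClosure_eq_top_iff,
      Submodule.eq_bot_iff]
    intro ψ hψ
    refine eq_zero_of_inner_coherent b fun β => ?_
    rw [Submodule.mem_orthogonal] at hψ
    exact hψ _ ⟨Finsupp.single β 1, by simp [coherentComb]⟩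
  exact hd

/-- The displacement (Weyl) operator `D(z) = exp(z a† - z̄ a)`, defined as the continuous linear
operator with `D(z)|β⟩ = e^{(zβ̄ - z̄β)/2} |z + β⟩` for every coherent state `|β⟩`
(see `displacement_coherent`; the coherent states span a dense subspace). -/
def displacement (b : HilbertBasis ℕ ℂ H) (z : ℂ) : H →L[ℂ] H :=
  (displacedComb b z).extendOfNorm (coherentComb b)

theorem displacement_coherent (b : HilbertBasis ℕ ℂ H) (z β : ℂ) :
    displacement b z (coherent b β) =
      Complex.exp ((z * starRingEnd ℂ β - starRingEnd ℂ z * β) / 2) • coherent b (z + β) := by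
  have h := LinearMap.extendOfNorm_eq (f := displacedComb b z) (denseRange_coherentComb b)
    ⟨1, fun c => by rw [one_mul, norm_displacedComb]⟩ (Finsupp.single β 1)
  simpa [displacement, displacedComb, coherentComb] using h

/-! ### States, moments, Gaussian states -/

/-- Trace in the number basis (used for positive operators and for products of a bounded operator
with a density operator, where the sum converges absolutely). -/
def trace (b : HilbertBasis ℕ ℂ H) (T : H →L[ℂ] H) : ℂ := ∑' n, inner ℂ (b n) (T (b n))

/-- Density operators: positive operators of trace one. -/
def IsDensityOperator (b : HilbertBasis ℕ ℂ H) (ρ : H →L[ℂ] H) : Prop :=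
  ρ.IsPositive ∧ HasSum (fun n => inner ℂ (b n) (ρ (b n))) 1

/-- The expectation `tr(A ρ) = ∑ₙ ⟨n|Aρ|n⟩` of a polynomial `A` in `a` and `a†`. -/
def expectation (b : HilbertBasis ℕ ℂ H) (A : Module.End ℂ (ℕ → ℂ)) (ρ : H →L[ℂ] H) : ℂ :=
  ∑' n, A (amplitudes b (ρ (b n))) n

/-- Finite mean photon number `tr(a†a ρ) < ∞`, so that all first and second moments exist. -/
def HasFiniteEnergy (b : HilbertBasis ℕ ℂ H) (ρ : H →L[ℂ] H) : Prop :=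
  Summable fun n : ℕ => number (amplitudes b (ρ (b n))) n

/-- The displacement vector `r̄ᵢ = ⟨rᵢ⟩`. -/
def meanVector (b : HilbertBasis ℕ ℂ H) (ρ : H →L[ℂ] H) : Fin 2 → ℝ :=
  fun i => (expectation b (quadrature i) ρ).re

/-- The centred quadrature `rᵢ - ⟨rᵢ⟩`. -/
def centredQuadrature (b : HilbertBasis ℕ ℂ H) (ρ : H →L[ℂ] H) (i : Fin 2) :
    Module.End ℂ (ℕ → ℂ) :=
  quadrature i - (meanVector b ρ i : ℂ) • 1

/-- The covariance matrix `Γᵢⱼ = ½⟨{rᵢ - ⟨rᵢ⟩, rⱼ - ⟨rⱼ⟩}⟩`. -/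
def covarianceMatrix (b : HilbertBasis ℕ ℂ H) (ρ : H →L[ℂ] H) : Matrix (Fin 2) (Fin 2) ℝ :=
  fun i j => (expectation b
    ((1 / 2 : ℂ) • (centredQuadrature b ρ i * centredQuadrature b ρ j +
      centredQuadrature b ρ j * centredQuadrature b ρ i)) ρ).re

/-- The symplectic form of one mode. -/
def symplecticForm : Matrix (Fin 2) (Fin 2) ℝ := !![0, 1; -1, 0]

/-- The quantum characteristic function `χ_ρ(r) = tr(D(r) ρ)`, `D(r) = exp(i r̂ᵀ Ω r)`;
with `q = a + a†`, `p = i(a† - a)` this is the displacement by `z = r₁ + i r₂`. -/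
def characteristicFunction (b : HilbertBasis ℕ ℂ H) (ρ : H →L[ℂ] H) (r : Fin 2 → ℝ) : ℂ :=
  trace b (displacement b ((r 0 : ℂ) + (r 1 : ℂ) * Complex.I) ∘L ρ)

/-- Gaussian states: the characteristic function (equivalently, its Fourier transform, the Wigner
function) is Gaussian, determined by the displacement vector and the covariance matrix. -/
def IsGaussianState (b : HilbertBasis ℕ ℂ H) (τ : H →L[ℂ] H) : Prop :=
  IsDensityOperator b τ ∧ HasFiniteEnergy b τ ∧
    ∀ r : Fin 2 → ℝ, characteristicFunction b τ r =
      Complex.exp (Complex.I * ((meanVector b τ ⬝ᵥ symplecticForm.mulVec r : ℝ) : ℂ) -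
        ((symplecticForm.mulVec r ⬝ᵥ
          (covarianceMatrix b τ).mulVec (symplecticForm.mulVec r) : ℝ) : ℂ) / 2)

/-- `τ` is the Gaussian equivalent of `ρ`: the Gaussian state with the same first and second
moments. -/
def IsGaussianEquivalent (b : HilbertBasis ℕ ℂ H) (ρ τ : H →L[ℂ] H) : Prop :=
  HasFiniteEnergy b ρ ∧ IsGaussianState b τ ∧
    meanVector b τ = meanVector b ρ ∧ covarianceMatrix b τ = covarianceMatrix b ρ

/-- The Gaussian equivalent `ρ^G` (meaningful when it exists and is unique). -/
def gaussianEquivalent (b : HilbertBasis ℕ ℂ H) (ρ : H →L[ℂ] H) : H →L[ℂ] H :=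
  Classical.epsilon (IsGaussianEquivalent b ρ)

/-! ### Entropies -/

/-- The von Neumann entropy `S(ρ) = -tr(ρ log ρ) ∈ [0, ∞]`: the trace of the positive operator
`η(ρ)`, `η(x) = -x log x`. -/
def vonNeumannEntropy (b : HilbertBasis ℕ ℂ H) (ρ : H →L[ℂ] H) : ℝ≥0∞ :=
  ∑' n, ENNReal.ofReal (inner ℂ (b n) (cfc Real.negMulLog ρ (b n))).re

/-- The orthogonal projection onto the eigenspace `ker (ρ - p)`. -/
def eigenprojection (ρ : H →L[ℂ] H) (p : ℝ≥0) : H →L[ℂ] H :=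
  (ρ - ((p : ℝ) : ℂ) • (1 : H →L[ℂ] H)).ker.starProjection

/-- `tr(P_p Q_q) ∈ [0, ∞]` for the eigenprojections `P_p` of `ρ` and `Q_q` of `σ`. -/
def eigenOverlap (b : HilbertBasis ℕ ℂ H) (ρ σ : H →L[ℂ] H) (p q : ℝ≥0) : ℝ≥0∞ :=
  ∑' n, ‖eigenprojection ρ p (eigenprojection σ q (b n))‖ₑ ^ 2

/-- `p log p - p log q + q - p ≥ 0`, with value `∞` if `q = 0 < p` and `0 log 0 = 0`. -/
def relativeEntropyTerm (p q : ℝ≥0) : ℝ≥0∞ :=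
  if q = 0 ∧ p ≠ 0 then ∞
  else ENNReal.ofReal (p * Real.log p - p * Real.log q + q - p)

/-- The quantum relative entropy `S(ρ‖σ) = tr(ρ(log ρ - log σ)) ∈ [0, ∞]` of density operators, in
the spectral form `∑_{p,q} tr(P_p Q_q) (p log p - p log q + q - p)` over the eigenvalues of `ρ` and
`σ` (the terms `q - p` make every summand nonnegative and add up to `tr σ - tr ρ = 0`). -/
def relativeEntropy (b : HilbertBasis ℕ ℂ H) (ρ σ : H →L[ℂ] H) : ℝ≥0∞ :=
  ∑' p : ℝ≥0, ∑' q : ℝ≥0, eigenOverlap b ρ σ p q * relativeEntropyTerm p q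

/-- The relative-entropy non-Gaussianity `δ_vN(ρ) = S(ρ‖ρ^G)`. -/
def nonGaussianity (b : HilbertBasis ℕ ℂ H) (ρ : H →L[ℂ] H) : ℝ≥0∞ :=
  relativeEntropy b ρ (gaussianEquivalent b ρ)

/-! ### Constellations -/

/-- The mixture `ρ_X = ∑_{x ∈ 𝒳} Pr[X = x] |x⟩⟨x|` of coherent states induced by a random variable
`X` with finite alphabet `𝒳`. -/
def constellationState (b : HilbertBasis ℕ ℂ H) {Ω : Type*} [MeasurableSpace Ω]
    (P : Measure Ω) (X : Ω → ℂ) (𝒳 : Finset ℂ) : H →L[ℂ] H :=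
  ∑ x ∈ 𝒳, ((P.real {ω | X ω = x} : ℝ) : ℂ) •
    InnerProductSpace.rankOne ℂ (coherent b x) (coherent b x)

end Hilbert

/-- The circularly symmetric complex Gaussian law `ℂ𝒩(0, V)`: independent real and imaginary parts
with law `𝒩(0, V/2)`. -/
def complexGaussian (V : ℝ≥0) : Measure ℂ :=
  ((ProbabilityTheory.gaussianReal 0 (V / 2)).prod
    (ProbabilityTheory.gaussianReal 0 (V / 2))).map
      fun t : ℝ × ℝ => (t.1 : ℂ) + (t.2 : ℂ) * Complex.I

end CVQKD

end

/-!
The Gaussian equivalent of a centred constellation state with `𝔼|X|² = V` and `𝔼X² = 0` is the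
thermal state `τ = ∑ₙ Vⁿ/(1+V)ⁿ⁺¹ |n⟩⟨n|`: both have mean zero and covariance `(2V+1)·1`
(`HasThermalMoments`). Existence is the computation of the characteristic function of `τ`, through
the weak representation `τ = 𝔼 |X_G⟩⟨X_G|` (`integral_inner_rankOne_coherent`). Uniqueness holds
because the operators `|v⟩⟨w|` between coherent states are weak Gaussian integrals of displacement
operators, so that the characteristic function of a state determines its matrix elements between
coherent states (`IsDensityOperator.eq_of_characteristicFunction`). All weak operator integrals are
evaluated on coherent states, where they are the one Gaussian integral
`integral_cexp_complexGaussian`, and extended by density (`integral_inner_of_coherent`).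

The eigenvalues of `τ` are positive and simple with eigenvectors `|n⟩`, and their logarithms are
affine in `n`. Hence `-tr(ρ log τ)` depends only on the mean photon number of `ρ`, and summing the
spectral form of the relative entropy over the finitely many eigenvalues of a constellation state
gives `S(ρ‖τ) + S(ρ) = S(τ)` (`relativeEntropy_add_vonNeumannEntropy`).

It remains to bound the entropies of the constellation states from below in the limit. Convergence
in distribution makes every matrix element of `ρₙ` converge to that of `τ`, since
`x ↦ ⟨ψ|x⟩⟨x|φ⟩` is bounded and continuous. As the photon numbers are bounded in mean, the vectors
`ρₙ|k⟩` converge in norm (`tendsto_apply_basis`), so `|k⟩` is an asymptotic eigenvector of `ρₙ`, and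
by polynomial approximation one of `η(ρₙ)`, where `η(x) = -x log x` (`tendsto_cfc_apply`). Each
diagonal element of `η(ρₙ)` thus converges to that of `η(τ)`; all of them being nonnegative,
`liminf S(ρₙ) ≥ S(τ)`, which is the claim.
-/

noncomputable section

namespace CVQKD

/-! ### Gaussian integrals over the complex plane -/

theorem integral_cexp_gaussianReal {v : ℝ≥0} (hv : v ≠ 0) {c : ℝ} (hc : 0 ≤ c) (s : ℂ) :
    ∫ t : ℝ, Complex.exp (-c * (t : ℂ) ^ 2 + s * t) ∂(ProbabilityTheory.gaussianReal 0 v) =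
      ((√(1 + 2 * c * v))⁻¹ : ℝ) * Complex.exp (s ^ 2 * v / (2 * (1 + 2 * c * v))) := by
  have hv' : (0 : ℝ) < v := by positivity
  rw [ProbabilityTheory.integral_gaussianReal_eq_integral_smul hv]
  have hB : (-((c + 1 / (2 * v) : ℝ) : ℂ)).re < 0 := by
    rw [← Complex.ofReal_neg, Complex.ofReal_re]
    have : 0 < c + 1 / (2 * (v : ℝ)) := by positivity
    linarith
  have hvC : (v : ℂ) ≠ 0 := by exact_mod_cast hv'.ne'
  have hcC : (1 + 2 * c * v : ℂ) ≠ 0 := by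
    have : (1 + 2 * c * v : ℝ) ≠ 0 := by positivity
    exact_mod_cast this
  have hint : ∀ t : ℝ, ProbabilityTheory.gaussianPDFReal 0 v t •
      Complex.exp (-c * (t : ℂ) ^ 2 + s * t) = (((√(2 * Real.pi * v))⁻¹ : ℝ) : ℂ) *
        Complex.exp (-((c + 1 / (2 * v) : ℝ) : ℂ) * (t : ℂ) ^ 2 + s * t + 0) := by
    intro t
    rw [ProbabilityTheory.gaussianPDFReal, Complex.real_smul]
    push_cast
    rw [mul_assoc, ← Complex.exp_add]
    congr 2
    field_simp
    ring
  simp_rw [hint]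
  rw [integral_const_mul, integral_cexp_quadratic hB, ← mul_assoc]
  congr 1
  · have h1 : (Real.pi / - -((c + 1 / (2 * v) : ℝ) : ℂ)) =
        ((Real.pi / (c + 1 / (2 * v)) : ℝ) : ℂ) := by push_cast; simp
    have h2 : (1 / 2 : ℂ) = ((1 / 2 : ℝ) : ℂ) := by push_cast; rfl
    rw [h1, h2, ← Complex.ofReal_cpow (by positivity), ← Real.sqrt_eq_rpow, ← Complex.ofReal_mul]
    congr 1
    rw [← Real.sqrt_inv, ← Real.sqrt_mul (by positivity), ← Real.sqrt_inv]
    congr 1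
    have := Real.pi_pos.ne'
    field_simp
    ring
  · congr 1
    push_cast
    have h3 : (c + 1 / (2 * v) : ℂ) = (1 + 2 * c * v) / (2 * v) := by field_simp; ring
    rw [h3]
    field_simp
    ring

theorem integrable_cexp_gaussianReal {v : ℝ≥0} (hv : v ≠ 0) {c : ℝ} (hc : 0 ≤ c) (s : ℂ) :
    Integrable (fun t : ℝ => Complex.exp (-c * (t : ℂ) ^ 2 + s * t))
      (ProbabilityTheory.gaussianReal 0 v) := by
  by_contra h
  have h1 := integral_cexp_gaussianReal hv hc s
  rw [integral_undef h] at h1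
  have h2 : (0 : ℝ) < (√(1 + 2 * c * v))⁻¹ := by positivity
  exact mul_ne_zero (by exact_mod_cast h2.ne') (Complex.exp_ne_zero _) h1.symm

theorem measurable_realPair : Measurable fun t : ℝ × ℝ => (t.1 : ℂ) + (t.2 : ℂ) * Complex.I := by
  fun_prop

instance isProbabilityMeasure_complexGaussian (V : ℝ≥0) :
    IsProbabilityMeasure (complexGaussian V) :=
  Measure.isProbabilityMeasure_map measurable_realPair.aemeasurable

/-- The Gaussian exponential with linear terms in `z` and `z̄` factors over the real and imaginary
parts. -/
theorem cexp_quadratic_realPair (c : ℝ) (a d : ℂ) (t : ℝ × ℝ) :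
    Complex.exp (-c * (‖(t.1 : ℂ) + (t.2 : ℂ) * Complex.I‖ : ℂ) ^ 2 +
        a * ((t.1 : ℂ) + (t.2 : ℂ) * Complex.I) +
        d * starRingEnd ℂ ((t.1 : ℂ) + (t.2 : ℂ) * Complex.I)) =
      Complex.exp (-c * (t.1 : ℂ) ^ 2 + (a + d) * t.1) *
        Complex.exp (-c * (t.2 : ℂ) ^ 2 + Complex.I * (a - d) * t.2) := by
  rw [← Complex.exp_add]
  congr 1
  rw [← Complex.conj_mul']
  simp only [map_add, map_mul, Complex.conj_ofReal, Complex.conj_I]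
  linear_combination (c * (t.2 : ℂ) ^ 2) * Complex.I_sq

theorem integrable_cexp_complexGaussian {V : ℝ≥0} (hV : 0 < V) {c : ℝ} (hc : 0 ≤ c) (a d : ℂ) :
    Integrable (fun z : ℂ => Complex.exp (-c * (‖z‖ : ℂ) ^ 2 + a * z + d * starRingEnd ℂ z))
      (complexGaussian V) := by
  rw [complexGaussian, integrable_map_measure (by fun_prop) measurable_realPair.aemeasurable]
  have hv : V / 2 ≠ 0 := by positivity
  refine ((integrable_cexp_gaussianReal hv hc (a + d)).mul_prod
    (integrable_cexp_gaussianReal hv hc (Complex.I * (a - d)))).congr ?_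
  exact ae_of_all _ fun t => (cexp_quadratic_realPair c a d t).symm

theorem integral_cexp_complexGaussian {V : ℝ≥0} (hV : 0 < V) {c : ℝ} (hc : 0 ≤ c) (a d : ℂ) :
    ∫ z : ℂ, Complex.exp (-c * (‖z‖ : ℂ) ^ 2 + a * z + d * starRingEnd ℂ z)
        ∂(complexGaussian V) =
      (1 + c * V)⁻¹ * Complex.exp (a * d * V / (1 + c * V)) := by
  rw [complexGaussian, integral_map measurable_realPair.aemeasurable (by fun_prop)]
  have hv : V / 2 ≠ 0 := by positivity
  simp_rw [cexp_quadratic_realPair]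
  rw [integral_prod_mul (fun t : ℝ => Complex.exp (-c * (t : ℂ) ^ 2 + (a + d) * t))
    (fun t : ℝ => Complex.exp (-c * (t : ℂ) ^ 2 + Complex.I * (a - d) * t)),
    integral_cexp_gaussianReal hv hc, integral_cexp_gaussianReal hv hc]
  have hcV : (0 : ℝ) < 1 + c * V := by positivity
  have h1 : (1 + 2 * c * ((V / 2 : ℝ≥0) : ℝ)) = 1 + c * V := by push_cast; ring
  have h2 : (1 + 2 * c * (((V / 2 : ℝ≥0) : ℝ) : ℂ)) = 1 + c * V := by push_cast; ring
  rw [h1, h2, mul_mul_mul_comm, ← Complex.exp_add, ← Complex.ofReal_mul, ← mul_inv,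
    Real.mul_self_sqrt hcV.le]
  have hcC : (1 + c * V : ℂ) ≠ 0 := by exact_mod_cast hcV.ne'
  congr 2
  push_cast
  rw [mul_pow, Complex.I_sq]
  field_simp
  ring

/-! ### Extending identities from coherent states to all vectors -/

/-- A family of functions on the plane that depends on its parameter in a uniformly Lipschitz way
stays continuous under limits in the parameter. -/
theorem isClosed_setOf_continuous {E : Type*} [SeminormedAddCommGroup E] {F : E → ℂ → ℂ} {C : ℝ≥0}
    (hF : ∀ φ φ' x, ‖F φ x - F φ' x‖ ≤ C * ‖φ - φ'‖) : IsClosed {φ | Continuous (F φ)} := by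
  refine isClosed_of_closure_subset fun φ hφ => ?_
  refine continuous_of_uniform_approx_of_continuous fun u hu => ?_
  obtain ⟨ε, hε, hu⟩ := Metric.mem_uniformity_dist.mp hu
  have hC : (0 : ℝ) < C + 1 := by positivity
  obtain ⟨φ', h1, h2⟩ := Metric.mem_closure_iff.mp hφ (ε / (C + 1)) (by positivity)
  refine ⟨F φ', h1, fun x => hu ?_⟩
  rw [dist_eq_norm]
  rw [dist_eq_norm, lt_div_iff₀ hC] at h2
  refine (hF φ φ' x).trans_lt (lt_of_le_of_lt ?_ h2)
  nlinarith [norm_nonneg (φ - φ')]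

theorem continuous_integral_of_lipschitz {E : Type*} [SeminormedAddCommGroup E]
    {F : E → ℂ → ℂ} {C : ℝ≥0}
    (hF : ∀ φ φ' x, ‖F φ x - F φ' x‖ ≤ C * ‖φ - φ'‖) {μ : Measure ℂ} {g : ℂ → ℂ}
    (hi : ∀ φ, Integrable (fun x => g x * F φ x) μ) (hg : Integrable g μ) :
    Continuous fun φ => ∫ x, g x * F φ x ∂μ := by
  refine LipschitzWith.continuous (K := (∫ x, ‖g x‖ ∂μ).toNNReal * C)
    (LipschitzWith.of_dist_le_mul fun φ φ' => ?_)
  rw [dist_eq_norm, dist_eq_norm, ← integral_sub (hi φ) (hi φ'), NNReal.coe_mul,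
    Real.coe_toNNReal _ (integral_nonneg fun _ => norm_nonneg _), mul_assoc, ← integral_mul_const]
  refine norm_integral_le_of_norm_le (hg.norm.mul_const _) (ae_of_all _ fun x => ?_)
  rw [← mul_sub, norm_mul]
  exact mul_le_mul_of_nonneg_left (hF φ φ' x) (norm_nonneg _)

section Density

variable {H : Type*} [NormedAddCommGroup H] [InnerProductSpace ℂ H]

theorem continuous_coherent (b : HilbertBasis ℕ ℂ H) : Continuous (coherent b) := by
  rw [continuous_iff_continuousAt]
  intro y
  rw [ContinuousAt, tendsto_iff_norm_sub_tendsto_zero]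
  have h1 : ∀ x, ‖coherent b x - coherent b y‖ = √(2 - 2 * (Complex.exp (-(‖x‖ : ℂ) ^ 2 / 2 -
      (‖y‖ : ℂ) ^ 2 / 2 + starRingEnd ℂ x * y)).re) := by
    intro x
    have h := norm_sub_sq (𝕜 := ℂ) (coherent b x) (coherent b y)
    rw [norm_coherent, norm_coherent, inner_coherent] at h
    rw [← Real.sqrt_sq (norm_nonneg (coherent b x - coherent b y)), h]
    congr 1
    simp only [RCLike.re_to_complex]
    ring
  simp_rw [h1]
  have hc : Continuous fun x : ℂ => √(2 - 2 * (Complex.exp (-(‖x‖ : ℂ) ^ 2 / 2 -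
      (‖y‖ : ℂ) ^ 2 / 2 + starRingEnd ℂ x * y)).re) := by
    fun_prop
  have h2 := hc.tendsto y
  have e : -(‖y‖ : ℂ) ^ 2 / 2 - (‖y‖ : ℂ) ^ 2 / 2 + starRingEnd ℂ y * y = 0 := by
    rw [Complex.conj_mul']; ring
  rw [e] at h2
  simpa using h2

theorem norm_inner_map_sub_le {A : H →L[ℂ] H} (hA : ‖A‖ ≤ 1) (ψ φ φ' : H) :
    ‖inner ℂ ψ (A φ) - inner ℂ ψ (A φ')‖ ≤ ‖ψ‖ * ‖φ - φ'‖ := by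
  rw [← inner_sub_right, ← map_sub]
  refine (norm_inner_le_norm _ _).trans (mul_le_mul_of_nonneg_left ?_ (norm_nonneg _))
  simpa using A.le_of_opNorm_le hA (φ - φ')

theorem norm_inner_sub_map_le {A : H →L[ℂ] H} (hA : ‖A‖ ≤ 1) (φ ψ ψ' : H) :
    ‖inner ℂ ψ (A φ) - inner ℂ ψ' (A φ)‖ ≤ ‖φ‖ * ‖ψ - ψ'‖ := by
  rw [← inner_sub_left, mul_comm]
  refine (norm_inner_le_norm _ _).trans (mul_le_mul_of_nonneg_left ?_ (norm_nonneg _))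
  simpa using A.le_of_opNorm_le hA φ

theorem norm_inner_map_le {A : H →L[ℂ] H} (hA : ‖A‖ ≤ 1) (ψ φ : H) :
    ‖inner ℂ ψ (A φ)‖ ≤ ‖ψ‖ * ‖φ‖ := by
  simpa using norm_inner_map_sub_le hA ψ φ 0

theorem integrable_mul_inner {A : ℂ → H →L[ℂ] H} (hA : ∀ x, ‖A x‖ ≤ 1) {ψ φ : H}
    (hc : Continuous fun x => inner ℂ ψ (A x φ)) {μ : Measure ℂ} {g : ℂ → ℂ}
    (hg : Integrable g μ) : Integrable (fun x => g x * inner ℂ ψ (A x φ)) μ :=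
  hg.mul_bdd hc.aestronglyMeasurable (ae_of_all _ fun x => norm_inner_map_le (hA x) ψ φ)

variable [CompleteSpace H]

/-- A property that is closed under linear combinations and limits holds for all vectors as soon as
it holds for coherent states. -/
theorem coherent_induction (b : HilbertBasis ℕ ℂ H) {p : H → Prop}
    (hc : ∀ β, p (coherent b β)) (h0 : p 0) (hadd : ∀ φ ψ, p φ → p ψ → p (φ + ψ))
    (hsmul : ∀ (c : ℂ) φ, p φ → p (c • φ)) (hcl : IsClosed {ψ | p ψ}) (ψ : H) : p ψ := by
  refine (denseRange_coherentComb b).induction_on ψ hcl fun c => ?_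
  rw [coherentComb, Finsupp.linearCombination_apply, Finsupp.sum]
  exact Finset.sum_induction _ p hadd h0 fun β _ => hsmul _ _ (hc β)

/-- Weak continuity of a family of contractions may be tested on coherent states. -/
theorem continuous_inner_of_coherent (b : HilbertBasis ℕ ℂ H) {A : ℂ → H →L[ℂ] H}
    (hA : ∀ x, ‖A x‖ ≤ 1)
    (h : ∀ γ β, Continuous fun x => inner ℂ (coherent b γ) (A x (coherent b β))) (ψ φ : H) :
    Continuous fun x => inner ℂ ψ (A x φ) := by
  have h1 : ∀ γ φ, Continuous fun x => inner ℂ (coherent b γ) (A x φ) := by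
    intro γ φ
    refine coherent_induction b (p := fun φ => Continuous fun x => inner ℂ (coherent b γ) (A x φ))
      (h γ) ?_ ?_ ?_ ?_ φ
    · simpa using continuous_const
    · intro φ ψ h1 h2
      simp only [map_add, inner_add_right]
      exact h1.add h2
    · intro c φ h1
      simp only [map_smul, inner_smul_right]
      exact continuous_const.mul h1
    · exact isClosed_setOf_continuous (C := ‖coherent b γ‖₊)
        fun φ φ' x => norm_inner_map_sub_le (hA x) _ _ _
  refine coherent_induction b (p := fun ψ => Continuous fun x => inner ℂ ψ (A x φ))
    (fun γ => h1 γ φ) ?_ ?_ ?_ ?_ ψ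
  · simpa using continuous_const
  · intro φ ψ h1 h2
    simp only [inner_add_left]
    exact h1.add h2
  · intro c φ h1
    simp only [inner_smul_left]
    exact continuous_const.mul h1
  · exact isClosed_setOf_continuous (C := ‖φ‖₊) (F := fun ψ x => inner ℂ ψ (A x φ))
      fun ψ ψ' x => norm_inner_sub_map_le (hA x) _ _ _

/-- A weak integral of contractions may be computed on coherent states. -/
theorem integral_inner_of_coherent (b : HilbertBasis ℕ ℂ H) {A : ℂ → H →L[ℂ] H}
    (hA : ∀ x, ‖A x‖ ≤ 1)
    (h : ∀ γ β, Continuous fun x => inner ℂ (coherent b γ) (A x (coherent b β)))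
    {μ : Measure ℂ} {g : ℂ → ℂ} (hg : Integrable g μ) {T : H →L[ℂ] H}
    (hT : ∀ γ β, ∫ x, g x * inner ℂ (coherent b γ) (A x (coherent b β)) ∂μ =
      inner ℂ (coherent b γ) (T (coherent b β))) (ψ φ : H) :
    ∫ x, g x * inner ℂ ψ (A x φ) ∂μ = inner ℂ ψ (T φ) := by
  have hi : ∀ ψ φ, Integrable (fun x => g x * inner ℂ ψ (A x φ)) μ := fun ψ φ =>
    integrable_mul_inner hA (continuous_inner_of_coherent b hA h ψ φ) hg
  have h1 : ∀ γ φ, ∫ x, g x * inner ℂ (coherent b γ) (A x φ) ∂μ =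
      inner ℂ (coherent b γ) (T φ) := by
    intro γ φ
    refine coherent_induction b (p := fun φ => ∫ x, g x * inner ℂ (coherent b γ) (A x φ) ∂μ =
      inner ℂ (coherent b γ) (T φ)) (hT γ) ?_ ?_ ?_ ?_ φ
    · simp
    · intro φ ψ h1 h2
      simp only [map_add, inner_add_right, mul_add]
      rw [integral_add (hi _ _) (hi _ _), h1, h2]
    · intro c φ h1
      simp only [map_smul, inner_smul_right, mul_left_comm (g _)]
      rw [integral_const_mul, h1]
    · exact isClosed_eq (continuous_integral_of_lipschitz (C := ‖coherent b γ‖₊)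
        (fun φ φ' x => norm_inner_map_sub_le (hA x) _ _ _) (hi _) hg) (by fun_prop)
  refine coherent_induction b (p := fun ψ => ∫ x, g x * inner ℂ ψ (A x φ) ∂μ = inner ℂ ψ (T φ))
    (fun γ => h1 γ φ) ?_ ?_ ?_ ?_ ψ
  · simp
  · intro φ ψ h1 h2
    simp only [inner_add_left, mul_add]
    rw [integral_add (hi _ _) (hi _ _), h1, h2]
  · intro c φ h1
    simp only [inner_smul_left, mul_left_comm (g _)]
    rw [integral_const_mul, h1]
  · exact isClosed_eq (continuous_integral_of_lipschitz (C := ‖φ‖₊)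
      (F := fun ψ x => inner ℂ ψ (A x φ))
      (fun ψ ψ' x => norm_inner_sub_map_le (hA x) _ _ _) (fun ψ => hi ψ φ) hg) (by fun_prop)

/-- Bounded operators with the same matrix elements between coherent states agree. -/
theorem eq_of_inner_coherent (b : HilbertBasis ℕ ℂ H) {S T : H →L[ℂ] H}
    (h : ∀ γ β, inner ℂ (coherent b γ) (S (coherent b β)) =
      inner ℂ (coherent b γ) (T (coherent b β))) : S = T := by
  ext φ
  refine coherent_induction b (p := fun φ => S φ = T φ) (fun β => ?_) (by simp) ?_ ?_ ?_ φ
  · rw [← sub_eq_zero]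
    refine eq_zero_of_inner_coherent b fun γ => ?_
    rw [inner_sub_right, h, sub_self]
  · intro φ ψ h1 h2
    rw [map_add, map_add, h1, h2]
  · intro c φ h1
    rw [map_smul, map_smul, h1]
  · exact isClosed_eq (by fun_prop) (by fun_prop)

/-! ### Displacement operators -/

theorem norm_displacement_apply (b : HilbertBasis ℕ ℂ H) (z : ℂ) (ψ : H) :
    ‖displacement b z ψ‖ = ‖ψ‖ := by
  refine (denseRange_coherentComb b).induction_on ψ (isClosed_eq (by fun_prop) (by fun_prop)) ?_
  intro c
  rw [← norm_displacedComb b z c, displacement,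
    LinearMap.extendOfNorm_eq (f := displacedComb b z) (denseRange_coherentComb b)
    ⟨1, fun c => by rw [one_mul, norm_displacedComb]⟩]

theorem norm_displacement_le (b : HilbertBasis ℕ ℂ H) (z : ℂ) : ‖displacement b z‖ ≤ 1 :=
  ContinuousLinearMap.opNorm_le_bound _ zero_le_one fun ψ => by
    rw [norm_displacement_apply, one_mul]

/-- The matrix element of `D(z)`, split into a factor independent of `z` and a Gaussian in `z` with
linear terms. -/
theorem inner_displacement_coherent (b : HilbertBasis ℕ ℂ H) (z γ β : ℂ) :
    inner ℂ (coherent b γ) (displacement b z (coherent b β)) =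
      Complex.exp (-(‖γ‖ : ℂ) ^ 2 / 2 - (‖β‖ : ℂ) ^ 2 / 2 + starRingEnd ℂ γ * β) *
        Complex.exp (-((1 / 2 : ℝ) : ℂ) * (‖z‖ : ℂ) ^ 2 + starRingEnd ℂ γ * z +
          -β * starRingEnd ℂ z) := by
  rw [displacement_coherent, inner_smul_right, inner_coherent, ← Complex.exp_add,
    ← Complex.exp_add]
  congr 1
  simp only [← Complex.conj_mul', map_add]
  push_cast
  ring

theorem continuous_inner_displacement (b : HilbertBasis ℕ ℂ H) (ψ φ : H) :
    Continuous fun z => inner ℂ ψ (displacement b z φ) := by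
  refine continuous_inner_of_coherent b (norm_displacement_le b) (fun γ β => ?_) ψ φ
  simp_rw [inner_displacement_coherent]
  fun_prop

end Density

section Trace

variable {H : Type*} [NormedAddCommGroup H] [InnerProductSpace ℂ H]

/-! ### The trace against a density operator -/

theorem hasSum_norm_inner_sq (b : HilbertBasis ℕ ℂ H) (ψ : H) :
    HasSum (fun n => ‖inner ℂ (b n) ψ‖ ^ 2) (‖ψ‖ ^ 2) := by
  have h := (b.hasSum_inner_mul_inner ψ ψ).mapL Complex.reCLM
  have h1 : (Complex.reCLM (inner ℂ ψ ψ) : ℝ) = ‖ψ‖ ^ 2 := by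
    rw [inner_self_eq_norm_sq_to_K]
    norm_cast
  rw [h1] at h
  refine h.congr_fun fun n => ?_
  rw [← inner_conj_symm, Complex.mul_conj', RCLike.norm_conj]
  norm_cast

theorem eq_zero_of_inner_basis (b : HilbertBasis ℕ ℂ H) {ψ : H} (h : ∀ n, inner ℂ (b n) ψ = 0) :
    ψ = 0 := by
  have h1 := hasSum_norm_inner_sq b ψ
  simp only [h, norm_zero, ne_eq, OfNat.ofNat_ne_zero, not_false_eq_true, zero_pow] at h1
  simpa using h1.unique hasSum_zero

variable [CompleteSpace H]

/-- Cyclicity of the trace for a product of two Hilbert–Schmidt operators. -/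
theorem tsum_inner_comp_comm (b : HilbertBasis ℕ ℂ H) {C B : H →L[ℂ] H}
    (hC : Summable fun n => ‖C (b n)‖ ^ 2) (hB : Summable fun n => ‖B (b n)‖ ^ 2) :
    ∑' n, inner ℂ (b n) (C (B (b n))) =
      ∑' m, inner ℂ (ContinuousLinearMap.adjoint B (b m)) (C (b m)) := by
  have hs : ∀ {A : H →L[ℂ] H}, (Summable fun n => ‖A (b n)‖ ^ 2) →
      Summable fun p : ℕ × ℕ => ‖inner ℂ (b p.2) (A (b p.1))‖ ^ 2 := by
    intro A hA
    rw [summable_prod_of_nonneg fun p => by positivity]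
    refine ⟨fun n => (hasSum_norm_inner_sq b (A (b n))).summable, ?_⟩
    simpa only [(hasSum_norm_inner_sq b (A (b _))).tsum_eq] using hA
  have hF : Summable fun p : ℕ × ℕ =>
      inner ℂ (b p.1) (C (b p.2)) * inner ℂ (b p.2) (B (b p.1)) := by
    refine Summable.of_norm_bounded ((hs hC).prod_symm.add (hs hB)) fun p => ?_
    rw [norm_mul]
    simp only [Prod.fst_swap, Prod.snd_swap]
    nlinarith [sq_nonneg (‖inner ℂ (b p.1) (C (b p.2))‖ - ‖inner ℂ (b p.2) (B (b p.1))‖),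
      sq_nonneg ‖inner ℂ (b p.1) (C (b p.2))‖, sq_nonneg ‖inner ℂ (b p.2) (B (b p.1))‖]
  -- Both iterated sums of `⟨n|C|m⟩⟨m|B|n⟩` are evaluated by Parseval.
  have h := hF.tsum_comm (f := fun n m => inner ℂ (b n) (C (b m)) * inner ℂ (b m) (B (b n)))
  have h1 : ∀ n, ∑' m, inner ℂ (b n) (C (b m)) * inner ℂ (b m) (B (b n)) =
      inner ℂ (b n) (C (B (b n))) := by
    intro n
    simp_rw [← ContinuousLinearMap.adjoint_inner_left C]
    rw [b.tsum_inner_mul_inner]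
  have h2 : ∀ m, ∑' n, inner ℂ (b n) (C (b m)) * inner ℂ (b m) (B (b n)) =
      inner ℂ (ContinuousLinearMap.adjoint B (b m)) (C (b m)) := by
    intro m
    rw [← b.tsum_inner_mul_inner]
    refine tsum_congr fun n => ?_
    rw [ContinuousLinearMap.adjoint_inner_left, mul_comm]
  simp_rw [h1, h2] at h
  exact h.symm

theorem exists_sqrt_of_isPositive {ρ : H →L[ℂ] H} (hρ : ρ.IsPositive) :
    ∃ R : H →L[ℂ] H, ContinuousLinearMap.adjoint R = R ∧ ∀ ψ, R (R ψ) = ρ ψ := by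
  have h0 : 0 ≤ ρ := (ContinuousLinearMap.nonneg_iff_isPositive ρ).mpr hρ
  refine ⟨CFC.sqrt ρ,
    ((ContinuousLinearMap.nonneg_iff_isPositive _).mp (CFC.sqrt_nonneg ρ)).isSelfAdjoint,
    fun ψ => ?_⟩
  conv_rhs => rw [← CFC.sqrt_mul_sqrt_self ρ h0]
  rfl

/-- A density operator has a Hilbert–Schmidt square root, which turns the trace against it into an
absolutely convergent sum of diagonal matrix elements. -/
theorem IsDensityOperator.exists_sqrt {b : HilbertBasis ℕ ℂ H} {ρ : H →L[ℂ] H}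
    (hρ : IsDensityOperator b ρ) : ∃ R : H →L[ℂ] H, (Summable fun n => ‖R (b n)‖ ^ 2) ∧
      ∀ T : H →L[ℂ] H, trace b (T ∘L ρ) = ∑' m, inner ℂ (R (b m)) (T (R (b m))) := by
  obtain ⟨R, hRsa, hR2⟩ := exists_sqrt_of_isPositive hρ.1
  have hs : Summable fun n => ‖R (b n)‖ ^ 2 := by
    have h := (hρ.2.mapL Complex.reCLM).summable
    refine h.congr fun n => ?_
    rw [← hR2, ← ContinuousLinearMap.adjoint_inner_left, hRsa, inner_self_eq_norm_sq_to_K]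
    norm_cast
  refine ⟨R, hs, fun T => ?_⟩
  have hTR : Summable fun n => ‖(T ∘L R) (b n)‖ ^ 2 := by
    refine Summable.of_nonneg_of_le (fun _ => by positivity) (fun n => ?_) (hs.mul_left (‖T‖ ^ 2))
    rw [← mul_pow]
    exact pow_le_pow_left₀ (norm_nonneg _) (T.le_opNorm _) 2
  have h := tsum_inner_comp_comm b hTR hs
  rw [hRsa] at h
  simpa [hR2, trace] using h

/-- A weak integral of contractions may be taken inside the trace against a density operator. -/
theorem IsDensityOperator.integral_mul_trace {b : HilbertBasis ℕ ℂ H} {ρ : H →L[ℂ] H}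
    (hρ : IsDensityOperator b ρ) {A : ℂ → H →L[ℂ] H} (hA : ∀ x, ‖A x‖ ≤ 1)
    (hc : ∀ ψ φ, Continuous fun x => inner ℂ ψ (A x φ)) {μ : Measure ℂ} {g : ℂ → ℂ}
    (hg : Integrable g μ) {T : H →L[ℂ] H}
    (hT : ∀ ψ φ, ∫ x, g x * inner ℂ ψ (A x φ) ∂μ = inner ℂ ψ (T φ)) :
    ∫ x, g x * trace b (A x ∘L ρ) ∂μ = trace b (T ∘L ρ) := by
  obtain ⟨R, hs, hR⟩ := hρ.exists_sqrt
  simp_rw [hR, ← tsum_mul_left]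
  have hi := fun m => integrable_mul_inner hA (hc (R (b m)) (R (b m))) hg
  have h := hasSum_integral_of_summable_integral_norm hi ?_
  · rw [← h.tsum_eq]
    simp_rw [hT]
  · refine Summable.of_nonneg_of_le (fun _ => integral_nonneg fun _ => norm_nonneg _)
      (fun m => ?_) (hs.mul_left (∫ x, ‖g x‖ ∂μ))
    rw [← integral_mul_const]
    refine integral_mono (hi m).norm (hg.norm.mul_const _) fun x => ?_
    change ‖_ * _‖ ≤ _
    rw [norm_mul, sq]
    exact mul_le_mul_of_nonneg_left (norm_inner_map_le (hA x) _ _) (norm_nonneg _)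

theorem trace_rankOne_comp (b : HilbertBasis ℕ ℂ H) {ρ : H →L[ℂ] H} (hρ : ρ.IsPositive)
    (v w : H) : trace b (InnerProductSpace.rankOne ℂ v w ∘L ρ) = inner ℂ w (ρ v) := by
  have hsa : ContinuousLinearMap.adjoint ρ = ρ := hρ.isSelfAdjoint
  rw [trace, ← ContinuousLinearMap.adjoint_inner_left, hsa, ← b.tsum_inner_mul_inner]
  refine tsum_congr fun n => ?_
  rw [ContinuousLinearMap.comp_apply, InnerProductSpace.rankOne_apply, inner_smul_right,
    ← ContinuousLinearMap.adjoint_inner_left, hsa]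

/-! ### A state is determined by its characteristic function -/

/-- The rank-one operators `|v⟩⟨w|` between coherent states are Gaussian integrals of displacement
operators. -/
theorem integral_inner_displacement (b : HilbertBasis ℕ ℂ H) (v w : ℂ) (ψ φ : H) :
    ∫ z, Complex.exp (-starRingEnd ℂ w * z + v * starRingEnd ℂ z) *
        inner ℂ ψ (displacement b z φ) ∂(complexGaussian 2) =
      inner ℂ ψ (((1 / 2 * Complex.exp ((‖v‖ : ℂ) ^ 2 / 2 + (‖w‖ : ℂ) ^ 2 / 2 -
        starRingEnd ℂ w * v)) • InnerProductSpace.rankOne ℂ (coherent b v) (coherent b w)) φ) := by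
  refine integral_inner_of_coherent b (norm_displacement_le b)
    (fun γ β => continuous_inner_displacement b _ _) ?_ ?_ ψ φ
  · simpa using integrable_cexp_complexGaussian (V := 2) (by norm_num) le_rfl
      (-starRingEnd ℂ w) v
  · intro γ β
    have h := integral_cexp_complexGaussian (V := 2) (by norm_num) (c := 1 / 2) (by norm_num)
      (starRingEnd ℂ γ - starRingEnd ℂ w) (v - β)
    have h1 : ∀ z : ℂ, Complex.exp (-starRingEnd ℂ w * z + v * starRingEnd ℂ z) *
        inner ℂ (coherent b γ) (displacement b z (coherent b β)) =
        Complex.exp (-(‖γ‖ : ℂ) ^ 2 / 2 - (‖β‖ : ℂ) ^ 2 / 2 + starRingEnd ℂ γ * β) *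
        Complex.exp (-((1 / 2 : ℝ) : ℂ) * (‖z‖ : ℂ) ^ 2 +
          (starRingEnd ℂ γ - starRingEnd ℂ w) * z + (v - β) * starRingEnd ℂ z) := by
      intro z
      rw [inner_displacement_coherent, ← Complex.exp_add, ← Complex.exp_add, ← Complex.exp_add]
      congr 1
      ring
    simp_rw [h1]
    have h2 : (((1 + 1 / 2 * ((2 : ℝ≥0) : ℝ))⁻¹ : ℝ) : ℂ) = 1 / 2 := by norm_num
    have h3 : (starRingEnd ℂ γ - starRingEnd ℂ w) * (v - β) * ((2 : ℝ≥0) : ℝ) /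
        (1 + ((1 / 2 : ℝ) : ℂ) * ((2 : ℝ≥0) : ℝ)) =
        (starRingEnd ℂ γ - starRingEnd ℂ w) * (v - β) := by
      push_cast
      field_simp
      ring
    rw [integral_const_mul, h, h2, h3, smul_apply, InnerProductSpace.rankOne_apply,
      inner_smul_right, inner_smul_right, inner_coherent, inner_coherent, mul_left_comm,
      ← Complex.exp_add, mul_assoc, ← Complex.exp_add, ← Complex.exp_add]
    congr 2
    ring

/-- Integrating the characteristic function against Gaussians recovers all matrix elements between
coherent states. -/
theorem IsDensityOperator.eq_of_characteristicFunction {b : HilbertBasis ℕ ℂ H}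
    {ρ σ : H →L[ℂ] H} (hρ : IsDensityOperator b ρ) (hσ : IsDensityOperator b σ)
    (h : characteristicFunction b ρ = characteristicFunction b σ) : ρ = σ := by
  have hD : ∀ z, trace b (displacement b z ∘L ρ) = trace b (displacement b z ∘L σ) := by
    intro z
    have := congrFun h ![z.re, z.im]
    simpa [characteristicFunction, Complex.re_add_im] using this
  refine eq_of_inner_coherent b fun w v => ?_
  set K : ℂ := 1 / 2 * Complex.exp ((‖v‖ : ℂ) ^ 2 / 2 + (‖w‖ : ℂ) ^ 2 / 2 - starRingEnd ℂ w * v)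
    with hK
  have hK0 : K ≠ 0 := mul_ne_zero (by norm_num) (Complex.exp_ne_zero _)
  have hg : Integrable (fun z => Complex.exp (-starRingEnd ℂ w * z + v * starRingEnd ℂ z))
      (complexGaussian 2) := by
    simpa using integrable_cexp_complexGaussian (V := 2) (by norm_num) le_rfl
      (-starRingEnd ℂ w) v
  have key : ∀ {τ : H →L[ℂ] H}, IsDensityOperator b τ →
      ∫ z, Complex.exp (-starRingEnd ℂ w * z + v * starRingEnd ℂ z) *
        trace b (displacement b z ∘L τ) ∂(complexGaussian 2) =
      K * inner ℂ (coherent b w) (τ (coherent b v)) := by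
    intro τ hτ
    rw [hτ.integral_mul_trace (norm_displacement_le b) (continuous_inner_displacement b) hg
      (integral_inner_displacement b v w), ContinuousLinearMap.smul_comp,
      ← trace_rankOne_comp b hτ.1, ← hK]
    simp [trace, tsum_mul_left]
  refine mul_left_cancel₀ hK0 ?_
  rw [← key hρ, ← key hσ]
  simp_rw [hD]

end Trace

/-! ### Moments of the quadratures -/

theorem annihilation_mul_creation : annihilation * creation = number + 1 := by
  refine LinearMap.ext fun ψ => funext fun n => ?_
  have h1 : ∀ x : ℝ, 0 ≤ x → (√x : ℂ) * (√x : ℂ) = x := fun x hx => by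
    rw [← Complex.ofReal_mul, Real.mul_self_sqrt hx]
  rcases n with _ | n
  · simp [number, annihilation, creation]
  · simp only [number, annihilation, creation, Module.End.mul_apply, LinearMap.coe_mk,
      AddHom.coe_mk, LinearMap.add_apply, Module.End.one_apply, Pi.add_apply]
    push_cast
    have h2 := h1 ((n : ℝ) + 1) (by positivity)
    have h3 := h1 ((n : ℝ) + 1 + 1) (by positivity)
    push_cast at h2 h3
    rw [← mul_assoc, ← mul_assoc, h2, h3]
    ring

theorem number_apply (ψ : ℕ → ℂ) (n : ℕ) : number ψ n = n * ψ n := by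
  rcases n with _ | n
  · simp [number, annihilation, creation]
  · have h2 : (√((n : ℝ) + 1) : ℂ) * (√((n : ℝ) + 1) : ℂ) = ((n : ℝ) + 1 : ℝ) := by
      rw [← Complex.ofReal_mul, Real.mul_self_sqrt (by positivity)]
    simp only [number, annihilation, creation, Module.End.mul_apply, LinearMap.coe_mk,
      AddHom.coe_mk]
    push_cast at h2 ⊢
    rw [← mul_assoc, h2]

section Moments

variable {H : Type*} [NormedAddCommGroup H] [InnerProductSpace ℂ H]

/-- The series defining `tr(A ρ)` converges with sum `m`. -/
def HasMoment (b : HilbertBasis ℕ ℂ H) (ρ : H →L[ℂ] H) (A : Module.End ℂ (ℕ → ℂ)) (m : ℂ) :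
    Prop :=
  HasSum (fun n => A (amplitudes b (ρ (b n))) n) m

theorem HasMoment.add {b : HilbertBasis ℕ ℂ H} {ρ : H →L[ℂ] H} {A B : Module.End ℂ (ℕ → ℂ)}
    {m k : ℂ} (hA : HasMoment b ρ A m) (hB : HasMoment b ρ B k) :
    HasMoment b ρ (A + B) (m + k) :=
  HasSum.add hA hB

theorem HasMoment.sub {b : HilbertBasis ℕ ℂ H} {ρ : H →L[ℂ] H} {A B : Module.End ℂ (ℕ → ℂ)}
    {m k : ℂ} (hA : HasMoment b ρ A m) (hB : HasMoment b ρ B k) :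
    HasMoment b ρ (A - B) (m - k) :=
  HasSum.sub hA hB

theorem HasMoment.smul {b : HilbertBasis ℕ ℂ H} {ρ : H →L[ℂ] H} {A : Module.End ℂ (ℕ → ℂ)}
    {m : ℂ} (c : ℂ) (hA : HasMoment b ρ A m) : HasMoment b ρ (c • A) (c * m) :=
  HasSum.mul_left c hA

theorem HasMoment.expectation_eq {b : HilbertBasis ℕ ℂ H} {ρ : H →L[ℂ] H}
    {A : Module.End ℂ (ℕ → ℂ)} {m : ℂ} (hA : HasMoment b ρ A m) : expectation b A ρ = m :=
  HasSum.tsum_eq hA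

/-- The moments of `ρ` up to second order are those of the thermal state with mean photon number
`N`. The moment of `a a†` is omitted, as it follows from `a a† = a† a + 1`. -/
structure HasThermalMoments (b : HilbertBasis ℕ ℂ H) (ρ : H →L[ℂ] H) (N : ℝ) : Prop where
  one : HasMoment b ρ 1 1
  annihilation : HasMoment b ρ annihilation 0
  creation : HasMoment b ρ creation 0
  annihilation_sq : HasMoment b ρ (CVQKD.annihilation * CVQKD.annihilation) 0
  creation_sq : HasMoment b ρ (CVQKD.creation * CVQKD.creation) 0
  number : HasMoment b ρ number N

namespace HasThermalMoments

variable {b : HilbertBasis ℕ ℂ H} {ρ : H →L[ℂ] H} {N : ℝ}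

theorem hasFiniteEnergy (h : HasThermalMoments b ρ N) : HasFiniteEnergy b ρ :=
  HasSum.summable h.number

theorem meanVector_eq (h : HasThermalMoments b ρ N) : meanVector b ρ = 0 := by
  have h0 : HasMoment b ρ (quadrature 0) (0 + 0) := h.annihilation.add h.creation
  have h1 : HasMoment b ρ (quadrature 1) (Complex.I * (0 - 0)) :=
    (h.creation.sub h.annihilation).smul Complex.I
  funext i
  fin_cases i
  · simp [meanVector, h0.expectation_eq]
  · simp [meanVector, h1.expectation_eq]

theorem centredQuadrature_eq (h : HasThermalMoments b ρ N) (i : Fin 2) :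
    centredQuadrature b ρ i = quadrature i := by
  simp [centredQuadrature, h.meanVector_eq]

theorem covarianceMatrix_eq (h : HasThermalMoments b ρ N) :
    covarianceMatrix b ρ = (2 * N + 1) • (1 : Matrix (Fin 2) (Fin 2) ℝ) := by
  have hc := annihilation_mul_creation
  have hn : CVQKD.creation * CVQKD.annihilation = CVQKD.number := rfl
  have h00 : (1 / 2 : ℂ) • (quadrature 0 * quadrature 0 + quadrature 0 * quadrature 0) =
      (CVQKD.annihilation * CVQKD.annihilation + CVQKD.creation * CVQKD.creation) +
        ((2 : ℂ) • CVQKD.number + 1) := by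
    simp only [quadrature, Matrix.cons_val_zero, mul_add, add_mul, hc, hn]
    module
  have h11 : (1 / 2 : ℂ) • (quadrature 1 * quadrature 1 + quadrature 1 * quadrature 1) =
      ((2 : ℂ) • CVQKD.number + 1) -
        (CVQKD.annihilation * CVQKD.annihilation + CVQKD.creation * CVQKD.creation) := by
    simp only [quadrature, Matrix.cons_val_one, Matrix.cons_val_fin_one, mul_sub, sub_mul, hc, hn,
      smul_mul_assoc, mul_smul_comm, smul_sub, smul_smul, Complex.I_mul_I]
    module
  have h01 : (1 / 2 : ℂ) • (quadrature 0 * quadrature 1 + quadrature 1 * quadrature 0) =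
      Complex.I • (CVQKD.creation * CVQKD.creation -
        CVQKD.annihilation * CVQKD.annihilation) := by
    simp only [quadrature, Matrix.cons_val_zero, Matrix.cons_val_one, Matrix.cons_val_fin_one,
      mul_sub, sub_mul, mul_add, add_mul, hc, hn, smul_mul_assoc, mul_smul_comm]
    module
  have m00 := (h.annihilation_sq.add h.creation_sq).add ((h.number.smul 2).add h.one)
  have m11 := ((h.number.smul 2).add h.one).sub (h.annihilation_sq.add h.creation_sq)
  have m01 := (h.creation_sq.sub h.annihilation_sq).smul Complex.I
  rw [← h00] at m00
  rw [← h11] at m11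
  rw [← h01] at m01
  have m10 := m01
  rw [add_comm] at m10
  ext i j
  fin_cases i <;> fin_cases j
  · simpa [covarianceMatrix, h.centredQuadrature_eq] using congrArg Complex.re m00.expectation_eq
  · simpa [covarianceMatrix, h.centredQuadrature_eq] using congrArg Complex.re m01.expectation_eq
  · simpa [covarianceMatrix, h.centredQuadrature_eq] using congrArg Complex.re m10.expectation_eq
  · simpa [covarianceMatrix, h.centredQuadrature_eq] using congrArg Complex.re m11.expectation_eq

/-- The diagonal of `ρ` is a probability distribution on the photon number. -/
theorem hasSum_diagonal (h : HasThermalMoments b ρ N) :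
    HasSum (fun n => (inner ℂ (b n) (ρ (b n))).re) 1 := by
  simpa [amplitudes] using Complex.reCLM.hasSum h.one

theorem hasSum_nat_mul_diagonal (h : HasThermalMoments b ρ N) :
    HasSum (fun n : ℕ => (n : ℝ) * (inner ℂ (b n) (ρ (b n))).re) N := by
  have h1 := Complex.reCLM.hasSum h.number
  simpa [number_apply, amplitudes] using h1

end HasThermalMoments

/-! ### Moments of a mixture of coherent states -/

theorem inner_basis_coherent (b : HilbertBasis ℕ ℂ H) (n : ℕ) (x : ℂ) :
    inner ℂ (b n) (coherent b x) = coherentSeq x n := by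
  rw [← b.repr_apply_apply, coherent, LinearIsometryEquiv.apply_symm_apply]

theorem sqrt_mul_coherentSeq_succ (x : ℂ) (n : ℕ) :
    (√((n : ℝ) + 1) : ℂ) * coherentSeq x (n + 1) = x * coherentSeq x n := by
  have h0 : (√((n : ℝ) + 1) : ℂ) ≠ 0 := by
    exact_mod_cast (Real.sqrt_pos.mpr (by positivity : (0 : ℝ) < n + 1)).ne'
  have h1 : (√(n.factorial : ℝ) : ℂ) ≠ 0 := by
    exact_mod_cast (Real.sqrt_pos.mpr (by positivity : (0 : ℝ) < n.factorial)).ne'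
  rw [coherentSeq_apply, coherentSeq_apply, Nat.factorial_succ]
  push_cast
  rw [Real.sqrt_mul (by positivity)]
  push_cast
  field_simp
  ring

/-- Coherent states are eigenvectors of the annihilation operator. -/
theorem annihilation_coherentSeq (x : ℂ) :
    annihilation (fun n => coherentSeq x n) = x • fun n => coherentSeq x n :=
  funext fun n => sqrt_mul_coherentSeq_succ x n

/-- Against a coherent state on the left, the creation operator acts as multiplication by `x̄`. -/
theorem hasSum_conj_coherentSeq_mul_creation {x : ℂ} {φ : ℕ → ℂ} {m : ℂ}
    (h : HasSum (fun n => starRingEnd ℂ (coherentSeq x n) * φ n) m) :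
    HasSum (fun n => starRingEnd ℂ (coherentSeq x n) * creation φ n) (starRingEnd ℂ x * m) := by
  rw [← hasSum_nat_add_iff' 1]
  have h0 : ∑ i ∈ Finset.range 1, starRingEnd ℂ (coherentSeq x i) * creation φ i = 0 := by
    simp [creation]
  rw [h0, sub_zero]
  refine (h.mul_left (starRingEnd ℂ x)).congr_fun fun n => ?_
  have h1 := congrArg (starRingEnd ℂ) (sqrt_mul_coherentSeq_succ x n)
  rw [map_mul, map_mul, Complex.conj_ofReal] at h1
  simp only [creation, LinearMap.coe_mk, AddHom.coe_mk, Nat.add_sub_cancel]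
  push_cast
  rw [← mul_assoc, ← mul_assoc, ← h1, mul_comm (starRingEnd ℂ _)]

theorem hasSum_conj_coherentSeq_mul_self (x : ℂ) :
    HasSum (fun n => starRingEnd ℂ (coherentSeq x n) * coherentSeq x n) 1 := by
  have h := (hasSum_coherent_sq x).mapL Complex.ofRealCLM
  simp only [Complex.ofRealCLM_apply, Complex.ofReal_one] at h
  refine h.congr_fun fun n => ?_
  rw [Complex.conj_mul', coherentSeq_apply]
  push_cast
  rfl

/-- A moment of a mixture of coherent states is the average of the coherent-state expectations,
whose series are `∑ₙ c̄ₙ (A c)ₙ` for the amplitudes `c` of `|x⟩`. -/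
theorem hasMoment_constellation (b : HilbertBasis ℕ ℂ H) {s : Finset ℂ} {p : ℂ → ℝ}
    {A : Module.End ℂ (ℕ → ℂ)} {m : ℂ → ℂ}
    (h : ∀ x, HasSum (fun n => starRingEnd ℂ (coherentSeq x n) *
      A (fun k => coherentSeq x k) n) (m x)) :
    HasMoment b (∑ x ∈ s, (p x : ℂ) •
      InnerProductSpace.rankOne ℂ (coherent b x) (coherent b x)) A (∑ x ∈ s, p x * m x) := by
  refine (hasSum_sum (f := fun x n => (p x : ℂ) * (starRingEnd ℂ (coherentSeq x n) *
    A (fun k => coherentSeq x k) n)) fun x _ => (h x).mul_left _).congr_fun fun n => ?_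
  have h1 : amplitudes b ((∑ x ∈ s, (p x : ℂ) •
      InnerProductSpace.rankOne ℂ (coherent b x) (coherent b x)) (b n)) =
      ∑ x ∈ s, ((p x : ℂ) * starRingEnd ℂ (coherentSeq x n)) • fun k => coherentSeq x k := by
    funext k
    rw [amplitudes, sum_apply, inner_sum, Finset.sum_apply]
    refine Finset.sum_congr rfl fun x _ => ?_
    rw [smul_apply, InnerProductSpace.rankOne_apply, inner_smul_right,
      inner_smul_right, inner_basis_coherent, ← inner_conj_symm, inner_basis_coherent,
      Pi.smul_apply, smul_eq_mul, mul_assoc]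
  rw [h1, map_sum, Finset.sum_apply]
  refine Finset.sum_congr rfl fun x _ => ?_
  rw [map_smul, Pi.smul_apply, smul_eq_mul, mul_assoc]

theorem hasThermalMoments_constellation (b : HilbertBasis ℕ ℂ H) {s : Finset ℂ} {p : ℂ → ℝ}
    {V : ℝ} (h1 : ∑ x ∈ s, (p x : ℂ) = 1) (hx : ∑ x ∈ s, p x * x = 0)
    (hxx : ∑ x ∈ s, p x * x ^ 2 = 0) (hV : ∑ x ∈ s, (p x : ℂ) * (‖x‖ : ℂ) ^ 2 = V) :
    HasThermalMoments b (∑ x ∈ s, (p x : ℂ) •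
      InnerProductSpace.rankOne ℂ (coherent b x) (coherent b x)) V := by
  have m1 := hasSum_conj_coherentSeq_mul_self
  have ma : ∀ x, HasSum (fun n => starRingEnd ℂ (coherentSeq x n) *
      annihilation (fun k => coherentSeq x k) n) x := by
    intro x
    rw [annihilation_coherentSeq]
    simpa [mul_left_comm] using (m1 x).mul_left x
  have maa : ∀ x, HasSum (fun n => starRingEnd ℂ (coherentSeq x n) *
      (annihilation * annihilation) (fun k => coherentSeq x k) n) (x ^ 2) := by
    intro x
    rw [Module.End.mul_apply, annihilation_coherentSeq, map_smul]
    simpa [mul_left_comm, sq] using (ma x).mul_left x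
  have mc := fun x => hasSum_conj_coherentSeq_mul_creation (m1 x)
  have mcc := fun x => hasSum_conj_coherentSeq_mul_creation (mc x)
  have mn := fun x => hasSum_conj_coherentSeq_mul_creation (ma x)
  have hcx : ∑ x ∈ s, (p x : ℂ) * starRingEnd ℂ x = 0 := by
    have := congrArg (starRingEnd ℂ) hx
    simpa using this
  have hcxx : ∑ x ∈ s, (p x : ℂ) * (starRingEnd ℂ x * starRingEnd ℂ x) = 0 := by
    have := congrArg (starRingEnd ℂ) hxx
    simpa [sq] using this
  refine ⟨?_, ?_, ?_, ?_, ?_, ?_⟩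
  · simpa [h1] using hasMoment_constellation b (s := s) (p := p) (A := 1) m1
  · simpa [hx] using hasMoment_constellation b (s := s) (p := p) ma
  · simpa [hcx] using hasMoment_constellation b (s := s) (p := p) mc
  · simpa [hxx] using hasMoment_constellation b (s := s) (p := p) maa
  · simpa [hcxx] using hasMoment_constellation b (s := s) (p := p)
      (A := creation * creation) mcc
  · rw [← hV]
    simpa [Complex.conj_mul'] using hasMoment_constellation b (s := s) (p := p) (A := number) mn

end Moments

/-! ### The thermal state -/

/-- The geometric photon-number distribution `Vⁿ / (1 + V)ⁿ⁺¹` with mean `V`. -/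
def thermalWeight (V : ℝ≥0) (n : ℕ) : ℝ≥0 := (1 + V)⁻¹ * (V / (1 + V)) ^ n

theorem thermalWeight_pos {V : ℝ≥0} (hV : 0 < V) (n : ℕ) : 0 < thermalWeight V n := by
  unfold thermalWeight; positivity

theorem thermalWeight_injective {V : ℝ≥0} (hV : 0 < V) : Function.Injective (thermalWeight V) := by
  intro m n h
  have h1 : (1 + V)⁻¹ ≠ 0 := by positivity
  have h2 := mul_left_cancel₀ h1 h
  refine pow_right_injective₀ (by positivity) ?_ h2
  exact ((div_lt_one (by positivity)).mpr (by simp)).ne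

theorem norm_ratio_lt_one (V : ℝ≥0) : ‖(V : ℝ) / (1 + V)‖ < 1 := by
  rw [Real.norm_of_nonneg (by positivity), div_lt_one (by positivity)]
  linarith

theorem hasSum_thermalWeight (V : ℝ≥0) : HasSum (fun n => (thermalWeight V n : ℝ)) 1 := by
  have h := (hasSum_geometric_of_norm_lt_one (norm_ratio_lt_one V)).mul_left (1 + (V : ℝ))⁻¹
  have e : (1 + (V : ℝ))⁻¹ * (1 - (V : ℝ) / (1 + V))⁻¹ = 1 := by
    have h0 : (1 + (V : ℝ)) ≠ 0 := by positivity
    have h1 : (1 - (V : ℝ) / (1 + V)) = (1 + (V : ℝ))⁻¹ := by field_simp; ring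
    rw [h1, inv_inv, inv_mul_cancel₀ h0]
  rw [e] at h
  exact h.congr_fun fun n => by simp [thermalWeight]

theorem hasSum_nat_mul_thermalWeight (V : ℝ≥0) :
    HasSum (fun n : ℕ => (n : ℝ) * thermalWeight V n) V := by
  have h := (hasSum_coe_mul_geometric_of_norm_lt_one (norm_ratio_lt_one V)).mul_left
    (1 + (V : ℝ))⁻¹
  have e : (1 + (V : ℝ))⁻¹ * ((V : ℝ) / (1 + V) / (1 - (V : ℝ) / (1 + V)) ^ 2) = V := by
    have h0 : (1 + (V : ℝ)) ≠ 0 := by positivity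
    have h1 : (1 - (V : ℝ) / (1 + V)) = (1 + (V : ℝ))⁻¹ := by field_simp; ring
    rw [h1]
    field_simp
  rw [e] at h
  refine h.congr_fun fun n => ?_
  simp only [thermalWeight]
  push_cast
  ring

theorem log_thermalWeight {V : ℝ≥0} (hV : 0 < V) (n : ℕ) :
    Real.log (thermalWeight V n) =
      -Real.log (1 + V) + n * Real.log ((V : ℝ) / (1 + V)) := by
  have h : (0 : ℝ) < V := hV
  simp only [thermalWeight]
  push_cast
  rw [Real.log_mul (by positivity) (by positivity), Real.log_inv, Real.log_pow]

section Thermal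

variable {H : Type*} [NormedAddCommGroup H] [InnerProductSpace ℂ H]

theorem norm_rankOne_coherent_le (b : HilbertBasis ℕ ℂ H) (x : ℂ) :
    ‖InnerProductSpace.rankOne ℂ (coherent b x) (coherent b x)‖ ≤ 1 := by
  rw [InnerProductSpace.norm_rankOne, norm_coherent, mul_one]

theorem continuous_inner_rankOne_coherent (b : HilbertBasis ℕ ℂ H) (ψ φ : H) :
    Continuous fun x =>
      inner ℂ ψ (InnerProductSpace.rankOne ℂ (coherent b x) (coherent b x) φ) := by
  have := continuous_coherent b
  simp_rw [InnerProductSpace.rankOne_apply]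
  fun_prop

variable [CompleteSpace H]

/-- The thermal state `∑ₙ Vⁿ/(1+V)ⁿ⁺¹ |n⟩⟨n|`, as a norm-convergent series. -/
def thermalState (b : HilbertBasis ℕ ℂ H) (V : ℝ≥0) : H →L[ℂ] H :=
  ∑' n, ((thermalWeight V n : ℝ) : ℂ) • InnerProductSpace.rankOne ℂ (b n) (b n)

theorem summable_thermalState (b : HilbertBasis ℕ ℂ H) (V : ℝ≥0) :
    Summable fun n =>
      ((thermalWeight V n : ℝ) : ℂ) • InnerProductSpace.rankOne ℂ (b n) (b n) := by
  refine Summable.of_norm_bounded (hasSum_thermalWeight V).summable fun n => ?_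
  rw [norm_smul, InnerProductSpace.norm_rankOne, b.orthonormal.1 n]
  simp

theorem hasSum_inner_thermalState (b : HilbertBasis ℕ ℂ H) (V : ℝ≥0) (ψ φ : H) :
    HasSum (fun n => ((thermalWeight V n : ℝ) : ℂ) * (inner ℂ ψ (b n) * inner ℂ (b n) φ))
      (inner ℂ ψ (thermalState b V φ)) := by
  have h := ((innerSL ℂ ψ).comp (ContinuousLinearMap.apply ℂ H φ)).hasSum
    (summable_thermalState b V).hasSum
  refine h.congr_fun fun n => ?_
  simp [mul_comm]

theorem thermalState_apply_basis (b : HilbertBasis ℕ ℂ H) (V : ℝ≥0) (k : ℕ) :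
    thermalState b V (b k) = ((thermalWeight V k : ℝ) : ℂ) • b k := by
  refine ext_inner_left ℂ fun ψ => (hasSum_inner_thermalState b V ψ (b k)).unique ?_
  rw [inner_smul_right]
  convert hasSum_single k fun n hn => ?_ using 1
  · rw [inner_self_eq_norm_sq_to_K, b.orthonormal.1 k]
    simp
  · rw [b.orthonormal.2 hn]
    simp

theorem isPositive_thermalState (b : HilbertBasis ℕ ℂ H) (V : ℝ≥0) :
    (thermalState b V).IsPositive := by
  rw [ContinuousLinearMap.isPositive_iff_complex]
  intro ψ
  have h := hasSum_inner_thermalState b V ψ ψ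
  have h1 : ∀ n, ((thermalWeight V n : ℝ) : ℂ) * (inner ℂ ψ (b n) * inner ℂ (b n) ψ) =
      ((thermalWeight V n * ‖inner ℂ (b n) ψ‖ ^ 2 : ℝ) : ℂ) := by
    intro n
    rw [← inner_conj_symm, Complex.conj_mul']
    push_cast
    rfl
  simp_rw [h1] at h
  have h2 := Complex.reCLM.hasSum h
  simp only [Complex.reCLM_apply, Complex.ofReal_re] at h2
  have h3 := h.unique (Complex.ofRealCLM.hasSum h2)
  have h4 : inner ℂ (thermalState b V ψ) ψ =
      (((inner ℂ ψ (thermalState b V ψ)).re : ℝ) : ℂ) := by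
    rw [← inner_conj_symm, h3]
    simp
  rw [h4]
  exact ⟨by simp, by simpa using h2.nonneg fun n => by positivity⟩

theorem hasThermalMoments_thermalState (b : HilbertBasis ℕ ℂ H) (V : ℝ≥0) :
    HasThermalMoments b (thermalState b V) V := by
  have h1 : ∀ n, amplitudes b (thermalState b V (b n)) =
      ((thermalWeight V n : ℝ) : ℂ) • Pi.single n 1 := by
    intro n
    funext m
    rw [amplitudes, thermalState_apply_basis, inner_smul_right,
      orthonormal_iff_ite.mp b.orthonormal, Pi.smul_apply, Pi.single_apply, smul_eq_mul]
  have key : ∀ {A : Module.End ℂ (ℕ → ℂ)} {f : ℕ → ℝ} {m : ℝ},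
      (∀ n, A (Pi.single n 1) n = f n) → HasSum (fun n => f n * thermalWeight V n) m →
      HasMoment b (thermalState b V) A m := by
    intro A f m hf hm
    refine (Complex.ofRealCLM.hasSum hm).congr_fun fun n => ?_
    rw [h1, map_smul, Pi.smul_apply, hf]
    simp [mul_comm]
  have key0 : ∀ {A : Module.End ℂ (ℕ → ℂ)}, (∀ n, A (Pi.single n 1) n = 0) →
      HasMoment b (thermalState b V) A 0 := by
    intro A hA
    simpa using key (f := 0) (m := 0) (by simpa using hA) (by simp)
  refine ⟨?_, ?_, ?_, ?_, ?_, ?_⟩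
  · rw [← Complex.ofReal_one]
    exact key (f := 1) (by simp) (by simpa using hasSum_thermalWeight V)
  · exact key0 fun n => by simp [annihilation]
  · refine key0 fun n => ?_
    rcases n with _ | n <;> simp [creation]
  · exact key0 fun n => by simp [annihilation, add_assoc]
  · refine key0 fun n => ?_
    rcases n with _ | n
    · simp [creation]
    · simp [creation, Pi.single_apply]
  · exact key (f := fun n => n) (fun n => by simp [number_apply])
      (hasSum_nat_mul_thermalWeight V)

theorem isDensityOperator_thermalState (b : HilbertBasis ℕ ℂ H) (V : ℝ≥0) :
    IsDensityOperator b (thermalState b V) :=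
  ⟨isPositive_thermalState b V, (hasThermalMoments_thermalState b V).one⟩

/-! ### The thermal state as a Gaussian mixture of coherent states -/

theorem inner_coherent_thermalState (b : HilbertBasis ℕ ℂ H) (V : ℝ≥0) (γ β : ℂ) :
    inner ℂ (coherent b γ) (thermalState b V (coherent b β)) =
      Complex.exp (-(‖γ‖ : ℂ) ^ 2 / 2 - (‖β‖ : ℂ) ^ 2 / 2) *
        ((1 + V : ℂ)⁻¹ * Complex.exp (starRingEnd ℂ γ * β * V / (1 + V))) := by
  refine (hasSum_inner_thermalState b V _ _).unique ?_
  have h := ((NormedSpace.expSeries_div_hasSum_exp (starRingEnd ℂ γ * β * V / (1 + V))).mul_left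
    ((1 + V : ℂ)⁻¹)).mul_left (Complex.exp (-(‖γ‖ : ℂ) ^ 2 / 2 - (‖β‖ : ℂ) ^ 2 / 2))
  rw [← Complex.exp_eq_exp_ℂ] at h
  refine h.congr_fun fun n => ?_
  have hn := sqrt_factorial_sq n
  have hn0 : (√(n.factorial : ℝ) : ℂ) ≠ 0 := by
    exact_mod_cast (Real.sqrt_pos.mpr (by positivity : (0 : ℝ) < n.factorial)).ne'
  rw [← inner_conj_symm, inner_basis_coherent, inner_basis_coherent, coherentSeq_apply,
    coherentSeq_apply, sub_eq_add_neg, Complex.exp_add, ← hn, thermalWeight]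
  simp only [map_mul, map_div₀, map_pow, Complex.conj_ofReal, mul_pow, div_pow]
  push_cast
  have e : -((‖β‖ : ℂ) ^ 2 / 2) = -(‖β‖ : ℂ) ^ 2 / 2 := by ring
  rw [e]
  have h0 : (1 + V : ℂ) ≠ 0 := by
    have : (1 + V : ℝ) ≠ 0 := by positivity
    exact_mod_cast this
  field_simp

/-- The thermal state is the Gaussian mixture of coherent states, in the weak sense. -/
theorem integral_inner_rankOne_coherent (b : HilbertBasis ℕ ℂ H) {V : ℝ≥0} (hV : 0 < V)
    (ψ φ : H) :
    ∫ x, inner ℂ ψ (InnerProductSpace.rankOne ℂ (coherent b x) (coherent b x) φ)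
      ∂(complexGaussian V) = inner ℂ ψ (thermalState b V φ) := by
  have h := integral_inner_of_coherent b (norm_rankOne_coherent_le b)
    (fun γ β => continuous_inner_rankOne_coherent b _ _) (μ := complexGaussian V)
    (g := fun _ => 1) (integrable_const _) (T := thermalState b V) ?_ ψ φ
  · simpa using h
  intro γ β
  have h1 : ∀ x : ℂ, 1 * inner ℂ (coherent b γ)
      (InnerProductSpace.rankOne ℂ (coherent b x) (coherent b x) (coherent b β)) =
      Complex.exp (-(‖γ‖ : ℂ) ^ 2 / 2 - (‖β‖ : ℂ) ^ 2 / 2) *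
        Complex.exp (-((1 : ℝ) : ℂ) * (‖x‖ : ℂ) ^ 2 + starRingEnd ℂ γ * x +
          β * starRingEnd ℂ x) := by
    intro x
    rw [one_mul, InnerProductSpace.rankOne_apply, inner_smul_right, inner_coherent,
      inner_coherent, ← Complex.exp_add, ← Complex.exp_add]
    congr 1
    push_cast
    ring
  simp_rw [h1]
  rw [integral_const_mul, integral_cexp_complexGaussian hV zero_le_one,
    inner_coherent_thermalState]
  push_cast
  simp

/-- The trace against the thermal state is the Gaussian average of the expectations in coherent
states. -/
theorem trace_comp_thermalState (b : HilbertBasis ℕ ℂ H) {V : ℝ≥0} (hV : 0 < V) {T : H →L[ℂ] H}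
    (hT : ‖T‖ ≤ 1) :
    trace b (T ∘L thermalState b V) =
      ∫ x, inner ℂ (coherent b x) (T (coherent b x)) ∂(complexGaussian V) := by
  have hcont := continuous_coherent b
  set F : ℕ → ℂ → ℂ := fun n x =>
    inner ℂ (coherent b x) (b n) * inner ℂ (b n) (T (coherent b x)) with hF
  have hFc : ∀ n, Continuous (F n) := fun n => by simp only [hF]; fun_prop
  -- Parseval bounds the partial sums uniformly in `x`, which justifies exchanging the sum over the
  -- basis with the Gaussian average.
  have hpt : ∀ (s : Finset ℕ) x, ∑ n ∈ s, ‖F n x‖ ≤ 1 := by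
    intro s x
    have h1 := sum_le_hasSum s (fun _ _ => by positivity) (hasSum_norm_inner_sq b (coherent b x))
    have h2 := sum_le_hasSum s (fun _ _ => by positivity)
      (hasSum_norm_inner_sq b (T (coherent b x)))
    have h3 : ‖T (coherent b x)‖ ≤ 1 := by
      simpa [norm_coherent] using T.le_of_opNorm_le hT (coherent b x)
    rw [norm_coherent] at h1
    have h4 : ‖T (coherent b x)‖ ^ 2 ≤ 1 := pow_le_one₀ (norm_nonneg _) h3
    have h5 : ∑ n ∈ s, ‖F n x‖ ≤ ∑ n ∈ s, (1 / 2) * (‖inner ℂ (b n) (coherent b x)‖ ^ 2 +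
        ‖inner ℂ (b n) (T (coherent b x))‖ ^ 2) := by
      refine Finset.sum_le_sum fun n _ => ?_
      simp only [hF]
      rw [norm_mul, norm_inner_symm]
      nlinarith [sq_nonneg (‖inner ℂ (b n) (coherent b x)‖ -
        ‖inner ℂ (b n) (T (coherent b x))‖)]
    rw [← Finset.mul_sum, Finset.sum_add_distrib] at h5
    linarith
  have hFi : ∀ n, Integrable (F n) (complexGaussian V) := fun n =>
    (integrable_const (1 : ℝ)).mono' (hFc n).aestronglyMeasurable
      (ae_of_all _ fun x => by simpa using hpt {n} x)
  have hsum : Summable fun n => ∫ x, ‖F n x‖ ∂(complexGaussian V) := by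
    refine summable_of_sum_le (c := 1) (fun n => integral_nonneg fun _ => norm_nonneg _)
      fun s => ?_
    rw [← integral_finsetSum _ fun n _ => (hFi n).norm]
    refine (integral_mono (integrable_finsetSum _ fun n _ => (hFi n).norm)
      (integrable_const (1 : ℝ)) (hpt s)).trans ?_
    simp
  have h := (hasSum_integral_of_summable_integral_norm hFi hsum).tsum_eq
  have h1 : ∀ x, ∑' n, F n x = inner ℂ (coherent b x) (T (coherent b x)) := fun x =>
    b.tsum_inner_mul_inner _ _
  simp_rw [h1] at h
  rw [← h, trace]
  refine tsum_congr fun n => ?_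
  rw [ContinuousLinearMap.comp_apply, ← ContinuousLinearMap.adjoint_inner_left,
    ← integral_inner_rankOne_coherent b hV]
  refine integral_congr_ae (ae_of_all _ fun x => ?_)
  simp only [hF]
  rw [InnerProductSpace.rankOne_apply, inner_smul_right, ContinuousLinearMap.adjoint_inner_left]

theorem characteristicFunction_thermalState (b : HilbertBasis ℕ ℂ H) {V : ℝ≥0} (hV : 0 < V)
    (r : Fin 2 → ℝ) :
    characteristicFunction b (thermalState b V) r =
      Complex.exp (-((2 * V + 1) * (r 0 ^ 2 + r 1 ^ 2) : ℝ) / 2) := by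
  rw [characteristicFunction, trace_comp_thermalState b hV (norm_displacement_le b _)]
  set z : ℂ := (r 0 : ℂ) + (r 1 : ℂ) * Complex.I with hz
  have h1 : ∀ x : ℂ, inner ℂ (coherent b x) (displacement b z (coherent b x)) =
      Complex.exp (-(‖z‖ : ℂ) ^ 2 / 2) *
        Complex.exp (-((0 : ℝ) : ℂ) * (‖x‖ : ℂ) ^ 2 + -starRingEnd ℂ z * x +
          z * starRingEnd ℂ x) := by
    intro x
    rw [inner_displacement_coherent, ← Complex.exp_add, ← Complex.exp_add]
    congr 1
    simp only [← Complex.conj_mul']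
    push_cast
    ring
  simp_rw [h1]
  rw [integral_const_mul, integral_cexp_complexGaussian hV le_rfl]
  simp only [zero_mul, add_zero, inv_one, Complex.ofReal_one, one_mul, Complex.ofReal_zero,
    div_one]
  rw [← Complex.exp_add, ← Complex.conj_mul']
  congr 1
  simp only [hz, map_add, map_mul, Complex.conj_ofReal, Complex.conj_I]
  push_cast
  linear_combination ((r 1 : ℂ) ^ 2 * (1 / 2 + V)) * Complex.I_sq

/-! ### The Gaussian equivalent of a state with thermal moments -/

theorem isGaussianEquivalent_thermalState {b : HilbertBasis ℕ ℂ H} {V : ℝ≥0} (hV : 0 < V)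
    {ρ : H →L[ℂ] H} (hρ : HasThermalMoments b ρ V) :
    IsGaussianEquivalent b ρ (thermalState b V) := by
  have hτ := hasThermalMoments_thermalState b V
  refine ⟨hρ.hasFiniteEnergy, ⟨isDensityOperator_thermalState b V, hτ.hasFiniteEnergy, ?_⟩, ?_, ?_⟩
  · intro r
    rw [characteristicFunction_thermalState b hV, hτ.meanVector_eq, hτ.covarianceMatrix_eq]
    congr 1
    simp [symplecticForm, Matrix.mulVec, dotProduct, Fin.sum_univ_two, Matrix.one_apply]
    ring
  · rw [hτ.meanVector_eq, hρ.meanVector_eq]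
  · rw [hτ.covarianceMatrix_eq, hρ.covarianceMatrix_eq]

theorem IsGaussianEquivalent.unique {b : HilbertBasis ℕ ℂ H} {ρ σ τ : H →L[ℂ] H}
    (hσ : IsGaussianEquivalent b ρ σ) (hτ : IsGaussianEquivalent b ρ τ) : σ = τ := by
  refine hσ.2.1.1.eq_of_characteristicFunction hτ.2.1.1 (funext fun r => ?_)
  rw [hσ.2.1.2.2, hτ.2.1.2.2, hσ.2.2.1, hσ.2.2.2, hτ.2.2.1, hτ.2.2.2]

theorem existsUnique_isGaussianEquivalent {b : HilbertBasis ℕ ℂ H} {V : ℝ≥0} (hV : 0 < V)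
    {ρ : H →L[ℂ] H} (hρ : HasThermalMoments b ρ V) : ∃! τ, IsGaussianEquivalent b ρ τ :=
  ⟨thermalState b V, isGaussianEquivalent_thermalState hV hρ, fun _ hσ =>
    hσ.unique (isGaussianEquivalent_thermalState hV hρ)⟩

theorem gaussianEquivalent_eq_thermalState {b : HilbertBasis ℕ ℂ H} {V : ℝ≥0} (hV : 0 < V)
    {ρ : H →L[ℂ] H} (hρ : HasThermalMoments b ρ V) :
    gaussianEquivalent b ρ = thermalState b V :=
  (Classical.epsilon_spec (p := IsGaussianEquivalent b ρ)
    ⟨_, isGaussianEquivalent_thermalState hV hρ⟩).unique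
      (isGaussianEquivalent_thermalState hV hρ)

end Thermal

section Spectral

variable {H : Type*} [NormedAddCommGroup H] [InnerProductSpace ℂ H] [CompleteSpace H]

/-! ### Functional calculus on approximate eigenvectors -/

omit [CompleteSpace H] in
theorem tendsto_aeval_apply {ι : Type*} {l : Filter ι} {T : ι → H →L[ℂ] H}
    (hT : ∀ i, ‖T i‖ ≤ 1) {ψ : H} {c : ℝ} (h : Tendsto (fun i => T i ψ) l (𝓝 ((c : ℂ) • ψ)))
    (p : Polynomial ℝ) :
    Tendsto (fun i => Polynomial.aeval (T i) p ψ) l (𝓝 (((p.eval c : ℝ) : ℂ) • ψ)) := by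
  have hpow : ∀ n : ℕ, Tendsto (fun i => (T i ^ n) ψ) l (𝓝 (((c : ℂ) ^ n) • ψ)) := by
    intro n
    induction n with
    | zero => simpa using tendsto_const_nhds
    | succ n ih =>
      have h1 : Tendsto (fun i => (T i) ((T i ^ n) ψ - ((c : ℂ) ^ n) • ψ)) l (𝓝 0) := by
        refine squeeze_zero_norm (fun i => ?_) (tendsto_iff_norm_sub_tendsto_zero.mp ih)
        rw [← one_mul ‖(T i ^ n) ψ - _‖]
        exact (T i).le_of_opNorm_le (hT i) _
      have h2 := h1.add (h.const_smul ((c : ℂ) ^ n))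
      rw [zero_add, smul_smul, ← pow_succ] at h2
      refine h2.congr fun i => ?_
      rw [pow_succ', map_sub, map_smul, sub_add_cancel]
      rfl
  induction p using Polynomial.induction_on' with
  | add p q hp hq =>
    have := hp.add hq
    simpa [add_smul] using this
  | monomial n a =>
    have := (hpow n).const_smul (a : ℂ)
    simpa [Polynomial.aeval_monomial, smul_smul, Algebra.algebraMap_eq_smul_one] using this

theorem spectrum_subset_Icc {T : H →L[ℂ] H} (hp : T.IsPositive) (hT : ‖T‖ ≤ 1) :
    spectrum ℝ T ⊆ Set.Icc 0 1 := by
  intro x hx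
  refine ⟨spectrum_nonneg_of_nonneg ((ContinuousLinearMap.nonneg_iff_isPositive T).mpr hp) hx, ?_⟩
  rcases subsingleton_or_nontrivial H with hH | hH
  · have : Subsingleton (H →L[ℂ] H) := inferInstance
    simp [spectrum.of_subsingleton] at hx
  · exact (le_abs_self x).trans ((spectrum.norm_le_norm_of_mem hx).trans hT)

/-- If `ψ` is an approximate eigenvector of `Tᵢ` with eigenvalue `c` in the limit, it is one of
`f(Tᵢ)` with eigenvalue `f(c)`: true for polynomials, and `f` is a uniform limit of these. -/
theorem tendsto_cfc_apply {ι : Type*} {l : Filter ι} {T : ι → H →L[ℂ] H}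
    (hp : ∀ i, (T i).IsPositive) (hT : ∀ i, ‖T i‖ ≤ 1) {ψ : H} {c : ℝ} (hc : c ∈ Set.Icc 0 1)
    (h : Tendsto (fun i => T i ψ) l (𝓝 ((c : ℂ) • ψ))) {f : ℝ → ℝ}
    (hf : ContinuousOn f (Set.Icc 0 1)) :
    Tendsto (fun i => cfc f (T i) ψ) l (𝓝 ((f c : ℂ) • ψ)) := by
  rw [Metric.tendsto_nhds]
  intro ε hε
  set δ := ε / (2 * (‖ψ‖ + 1)) with hδ
  have hψ : (0 : ℝ) < ‖ψ‖ + 1 := by positivity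
  have hδ0 : 0 < δ := by positivity
  obtain ⟨p, hpf⟩ := exists_polynomial_near_of_continuousOn 0 1 f hf δ hδ0
  have h1 : ∀ i, ‖cfc f (T i) ψ - Polynomial.aeval (T i) p ψ‖ ≤ δ * ‖ψ‖ := by
    intro i
    have hsa : IsSelfAdjoint (T i) := (hp i).isSelfAdjoint
    have hs := spectrum_subset_Icc (hp i) (hT i)
    rw [← cfc_polynomial p (T i) hsa, ← sub_apply, ← cfc_sub f p.eval (T i) (hf.mono hs)]
    refine ContinuousLinearMap.le_of_opNorm_le _ (norm_cfc_le hδ0.le fun x hx => ?_) ψ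
    rw [norm_sub_rev]
    exact (hpf x (hs hx)).le
  have h2 : ‖((p.eval c : ℝ) : ℂ) • ψ - (f c : ℂ) • ψ‖ ≤ δ * ‖ψ‖ := by
    rw [← sub_smul, norm_smul, ← Complex.ofReal_sub, Complex.norm_real]
    exact mul_le_mul_of_nonneg_right (hpf c hc).le (norm_nonneg _)
  have h3 := (Metric.tendsto_nhds.mp (tendsto_aeval_apply hT h p)) δ hδ0
  filter_upwards [h3] with i hi
  rw [dist_eq_norm] at hi ⊢
  have e : cfc f (T i) ψ - (f c : ℂ) • ψ = (cfc f (T i) ψ - Polynomial.aeval (T i) p ψ) +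
      (Polynomial.aeval (T i) p ψ - ((p.eval c : ℝ) : ℂ) • ψ) +
      (((p.eval c : ℝ) : ℂ) • ψ - (f c : ℂ) • ψ) := by abel
  rw [e]
  refine (norm_add₃_le).trans_lt ?_
  have h5 : δ * (2 * (‖ψ‖ + 1)) = ε := by rw [hδ]; field_simp
  linarith [h1 i, norm_nonneg ψ]

theorem cfc_apply_of_eigenvector {T : H →L[ℂ] H} (hp : T.IsPositive) (hT : ‖T‖ ≤ 1) {ψ : H}
    {c : ℝ} (hc : c ∈ Set.Icc 0 1) (h : T ψ = (c : ℂ) • ψ) {f : ℝ → ℝ}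
    (hf : ContinuousOn f (Set.Icc 0 1)) : cfc f T ψ = (f c : ℂ) • ψ :=
  tendsto_nhds_unique tendsto_const_nhds
    (tendsto_cfc_apply (l := atTop (α := ℕ)) (T := fun _ => T) (fun _ => hp) (fun _ => hT) hc
      (by rw [h]; exact tendsto_const_nhds) hf)

/-! ### Spectral decomposition of finite-rank states -/

omit [CompleteSpace H] in
theorem mem_ker_sub_smul_one {ρ : H →L[ℂ] H} {p : ℝ≥0} {v : H} :
    v ∈ (ρ - ((p : ℝ) : ℂ) • (1 : H →L[ℂ] H)).ker ↔ ρ v = ((p : ℝ) : ℂ) • v := by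
  rw [LinearMap.mem_ker]
  simp [sub_eq_zero]

theorem apply_eigenprojection (ρ : H →L[ℂ] H) (p : ℝ≥0) (ψ : H) :
    ρ (eigenprojection ρ p ψ) = ((p : ℝ) : ℂ) • eigenprojection ρ p ψ :=
  mem_ker_sub_smul_one.mp (Submodule.starProjection_apply_mem _ ψ)

theorem eigenprojection_of_eigenvector {ρ : H →L[ℂ] H} {p : ℝ≥0} {v : H}
    (hv : ρ v = ((p : ℝ) : ℂ) • v) : eigenprojection ρ p v = v :=
  Submodule.starProjection_eq_self_iff.mpr (mem_ker_sub_smul_one.mpr hv)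

theorem eigenprojection_of_eigenvector_ne {ρ : H →L[ℂ] H} (hρ : ρ.IsPositive) {p q : ℝ≥0}
    (hpq : p ≠ q) {v : H} (hv : ρ v = ((p : ℝ) : ℂ) • v) : eigenprojection ρ q v = 0 := by
  refine (Submodule.starProjection_apply_eq_zero_iff _).mpr fun w hw => ?_
  have h1 := mem_ker_sub_smul_one.mp hw
  have h2 := hρ.isSymmetric w v
  simp only [ContinuousLinearMap.coe_coe] at h2
  rw [h1, hv, inner_smul_left, inner_smul_right, Complex.conj_ofReal, ← sub_eq_zero,
    ← sub_mul] at h2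
  refine (mul_eq_zero.mp h2).resolve_left (sub_ne_zero.mpr fun h => hpq ?_)
  exact_mod_cast h.symm

theorem eigenprojection_ne_zero_iff {ρ : H →L[ℂ] H} {p : ℝ≥0} :
    eigenprojection ρ p ≠ 0 ↔ ∃ v, v ≠ 0 ∧ ρ v = ((p : ℝ) : ℂ) • v := by
  constructor
  · intro h
    obtain ⟨ψ, hψ⟩ := DFunLike.ne_iff.mp h
    exact ⟨_, hψ, apply_eigenprojection ρ p ψ⟩
  · rintro ⟨v, hv, h⟩ h0
    have h1 := eigenprojection_of_eigenvector h
    rw [h0] at h1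
    exact hv h1.symm

/-- A nonzero eigenvalue of `ρ` is an eigenvalue of its restriction to the range. -/
theorem finite_setOf_eigenprojection_ne_zero {ρ : H →L[ℂ] H}
    (hfin : FiniteDimensional ℂ ρ.range) : {p | eigenprojection ρ p ≠ 0}.Finite := by
  have hmap : ∀ x ∈ ρ.range, (ρ : H →ₗ[ℂ] H) x ∈ ρ.range := fun x _ => ⟨x, rfl⟩
  set S : Module.End ℂ ρ.range := (ρ : H →ₗ[ℂ] H).restrict hmap with hS
  have h1 : {p : ℝ≥0 | S.HasEigenvalue ((p : ℝ) : ℂ)}.Finite :=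
    S.finite_hasEigenvalue.preimage
      ((Complex.ofReal_injective.comp NNReal.coe_injective).injOn)
  refine (h1.insert 0).subset fun p hp => ?_
  obtain ⟨v, hv, h⟩ := eigenprojection_ne_zero_iff.mp hp
  rcases eq_or_ne p 0 with h0 | h0
  · exact Or.inl h0
  refine Or.inr ?_
  have hpC : ((p : ℝ) : ℂ) ≠ 0 := by exact_mod_cast h0
  have hvr : v ∈ ρ.range := ⟨((p : ℝ) : ℂ)⁻¹ • v, by
    rw [map_smul, ContinuousLinearMap.coe_coe, h, smul_smul, inv_mul_cancel₀ hpC, one_smul]⟩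
  refine Module.End.hasEigenvalue_of_hasEigenvector (x := ⟨v, hvr⟩)
    ⟨Module.End.mem_eigenspace_iff.mpr (Subtype.ext h), fun h2 => hv ?_⟩
  exact congrArg Subtype.val h2

omit [CompleteSpace H] in
theorem isCompactOperator_of_finiteDimensional_range {ρ : H →L[ℂ] H}
    (hfin : FiniteDimensional ℂ ρ.range) : IsCompactOperator ρ := by
  have h1 : IsCompactOperator (id : ρ.range → ρ.range) :=
    (isCompactOperator_id_iff_finiteDimensional (𝕜 := ℂ)).mpr hfin
  have h2 := (h1.comp_clm (ρ.codRestrict ρ.range fun x => ⟨x, rfl⟩)).clm_comp ρ.range.subtypeL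
  exact h2

/-- The eigenprojections of a positive finite-rank operator resolve the identity: a vector
orthogonal to all eigenspaces vanishes. -/
theorem sum_eigenprojection_apply {ρ : H →L[ℂ] H} (hρ : ρ.IsPositive)
    (hfin : FiniteDimensional ℂ ρ.range) {F : Finset ℝ≥0}
    (hF : ∀ p, eigenprojection ρ p ≠ 0 → p ∈ F) (ψ : H) :
    ∑ p ∈ F, eigenprojection ρ p ψ = ψ := by
  have hsym := hρ.isSymmetric
  have hbot := ContinuousLinearMap.orthogonalComplement_iSup_eigenspaces_eq_bot
    (isCompactOperator_of_finiteDimensional_range hfin) hsym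
  rw [eq_comm, ← sub_eq_zero, ← Submodule.mem_bot ℂ, ← hbot, ← Submodule.iInf_orthogonal,
    Submodule.mem_iInf]
  intro μ v hv
  rcases eq_or_ne v 0 with hv0 | hv0
  · simp [hv0]
  have hμ : (ρ : H →ₗ[ℂ] H) v = μ • v := Module.End.mem_eigenspace_iff.mp hv
  have hev : Module.End.HasEigenvalue (ρ : H →ₗ[ℂ] H) μ :=
    Module.End.hasEigenvalue_of_hasEigenvector ⟨hv, hv0⟩
  have hre : ((μ.re : ℝ) : ℂ) = μ := Complex.conj_eq_iff_re.mp (hsym.conj_eigenvalue_eq_self hev)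
  have h0 : 0 ≤ μ.re := by
    refine eigenvalue_nonneg_of_nonneg (T := (ρ : H →ₗ[ℂ] H)) (𝕜 := ℂ) ?_ fun x => ?_
    · rw [← hre] at hev; exact hev
    · exact hρ.re_inner_nonneg_right x
  set p : ℝ≥0 := ⟨μ.re, h0⟩ with hp
  have hvp : ρ v = ((p : ℝ) : ℂ) • v := by
    rw [show ((p : ℝ) : ℂ) = μ from hre]
    exact hμ
  have hpF : p ∈ F := hF p (eigenprojection_ne_zero_iff.mpr ⟨v, hv0, hvp⟩)
  have hsa : ∀ q φ, inner ℂ v (eigenprojection ρ q φ) = inner ℂ (eigenprojection ρ q v) φ :=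
    fun q φ => (Submodule.inner_starProjection_left_eq_right _ _ _).symm
  rw [inner_sub_right, inner_sum, Finset.sum_eq_single_of_mem p hpF, hsa,
    eigenprojection_of_eigenvector hvp, sub_self]
  intro q _ hq
  rw [hsa, eigenprojection_of_eigenvector_ne hρ hq.symm hvp, inner_zero_left]

/-- The spectral distribution of `ρ` in the state `ψ` integrates functions of `ρ`. -/
theorem sum_mul_norm_eigenprojection_sq {ρ : H →L[ℂ] H} (hρ : ρ.IsPositive) (hn : ‖ρ‖ ≤ 1)
    (hfin : FiniteDimensional ℂ ρ.range) {F : Finset ℝ≥0}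
    (hF : ∀ p, eigenprojection ρ p ≠ 0 → p ∈ F) {f : ℝ → ℝ} (hf : ContinuousOn f (Set.Icc 0 1))
    (ψ : H) :
    ∑ p ∈ F, f p * ‖eigenprojection ρ p ψ‖ ^ 2 = (inner ℂ ψ (cfc f ρ ψ)).re := by
  have h1 : ∀ p, cfc f ρ (eigenprojection ρ p ψ) = (f p : ℂ) • eigenprojection ρ p ψ := by
    intro p
    rcases eq_or_ne (eigenprojection ρ p ψ) 0 with h0 | h0
    · simp [h0]
    have hev := apply_eigenprojection ρ p ψ
    refine cfc_apply_of_eigenvector hρ hn ⟨p.2, ?_⟩ hev hf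
    have h2 := ρ.le_of_opNorm_le hn (eigenprojection ρ p ψ)
    rw [hev, norm_smul, Complex.norm_real, Real.norm_of_nonneg (NNReal.coe_nonneg p)] at h2
    exact le_of_mul_le_mul_right h2 (norm_pos_iff.mpr h0)
  conv_rhs => rw [← sum_eigenprojection_apply hρ hfin hF ψ, map_sum]
  rw [sum_eigenprojection_apply hρ hfin hF ψ, inner_sum, Complex.re_sum]
  refine Finset.sum_congr rfl fun p _ => ?_
  have h2 : inner ℂ ψ (eigenprojection ρ p ψ) = ((‖eigenprojection ρ p ψ‖ ^ 2 : ℝ) : ℂ) := by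
    have h3 : eigenprojection ρ p (eigenprojection ρ p ψ) = eigenprojection ρ p ψ :=
      eigenprojection_of_eigenvector (apply_eigenprojection ρ p ψ)
    have h4 : inner ℂ ψ (eigenprojection ρ p (eigenprojection ρ p ψ)) =
        inner ℂ (eigenprojection ρ p ψ) (eigenprojection ρ p ψ) :=
      (Submodule.inner_starProjection_left_eq_right _ _ _).symm
    rw [h3, inner_self_eq_norm_sq_to_K] at h4
    rw [h4]
    norm_cast
  rw [h1, inner_smul_right, h2, ← Complex.ofReal_mul, Complex.ofReal_re]

/-! ### Relative entropy to the thermal state -/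

theorem norm_thermalState_le (b : HilbertBasis ℕ ℂ H) (V : ℝ≥0) : ‖thermalState b V‖ ≤ 1 := by
  refine tsum_of_norm_bounded (hasSum_thermalWeight V) fun n => ?_
  rw [norm_smul, InnerProductSpace.norm_rankOne, b.orthonormal.1 n]
  simp

theorem thermalWeight_le_one (V : ℝ≥0) (n : ℕ) : (thermalWeight V n : ℝ) ≤ 1 :=
  le_hasSum (hasSum_thermalWeight V) n fun _ _ => NNReal.coe_nonneg _

theorem inner_basis_thermalState (b : HilbertBasis ℕ ℂ H) (V : ℝ≥0) (n : ℕ) (ψ : H) :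
    inner ℂ (b n) (thermalState b V ψ) = ((thermalWeight V n : ℝ) : ℂ) * inner ℂ (b n) ψ := by
  have h := (isPositive_thermalState b V).isSymmetric (b n) ψ
  simp only [ContinuousLinearMap.coe_coe] at h
  rw [← h, thermalState_apply_basis, inner_smul_left, Complex.conj_ofReal]

theorem eigenprojection_thermalState (b : HilbertBasis ℕ ℂ H) {V : ℝ≥0} (hV : 0 < V) (k : ℕ)
    (ψ : H) : eigenprojection (thermalState b V) (thermalWeight V k) ψ =
      (inner ℂ (b k) ψ : ℂ) • b k := by
  refine Submodule.eq_starProjection_of_mem_of_inner_eq_zero ?_ fun w hw => ?_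
  · exact mem_ker_sub_smul_one.mpr (by
      rw [map_smul, thermalState_apply_basis, smul_comm])
  · have hw' := mem_ker_sub_smul_one.mp hw
    have h0 : ∀ n, n ≠ k → inner ℂ (b n) w = 0 := by
      intro n hn
      have h1 := inner_basis_thermalState b V n w
      rw [hw', inner_smul_right, ← sub_eq_zero, ← sub_mul] at h1
      refine (mul_eq_zero.mp h1).resolve_left (sub_ne_zero.mpr fun h => hn ?_)
      exact (thermalWeight_injective hV (by exact_mod_cast h)).symm
    have h2 : w = (inner ℂ (b k) w : ℂ) • b k := by
      rw [← sub_eq_zero]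
      refine eq_zero_of_inner_basis b fun n => ?_
      rw [inner_sub_right, inner_smul_right, orthonormal_iff_ite.mp b.orthonormal]
      split_ifs with h
      · rw [h]; ring
      · rw [h0 n h]; ring
    rw [h2, inner_smul_right, inner_sub_left, inner_smul_left, inner_conj_symm,
      inner_self_eq_norm_sq_to_K, b.orthonormal.1 k]
    simp

theorem eigenprojection_thermalState_eq_zero (b : HilbertBasis ℕ ℂ H) {V : ℝ≥0} {q : ℝ≥0}
    (hq : q ∉ Set.range (thermalWeight V)) : eigenprojection (thermalState b V) q = 0 := by
  by_contra h
  obtain ⟨v, hv, h⟩ := eigenprojection_ne_zero_iff.mp h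
  refine hv (eq_zero_of_inner_basis b fun n => ?_)
  have h1 := inner_basis_thermalState b V n v
  rw [h, inner_smul_right, ← sub_eq_zero, ← sub_mul] at h1
  refine (mul_eq_zero.mp h1).resolve_left (sub_ne_zero.mpr fun h2 => hq ⟨n, ?_⟩)
  exact_mod_cast h2.symm

theorem eigenOverlap_thermalState (b : HilbertBasis ℕ ℂ H) {V : ℝ≥0} (hV : 0 < V)
    (ρ : H →L[ℂ] H) (p : ℝ≥0) (k : ℕ) :
    eigenOverlap b ρ (thermalState b V) p (thermalWeight V k) =
      ENNReal.ofReal (‖eigenprojection ρ p (b k)‖ ^ 2) := by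
  rw [eigenOverlap, tsum_eq_single k]
  · rw [eigenprojection_thermalState b hV, inner_self_eq_norm_sq_to_K, b.orthonormal.1 k,
      ENNReal.ofReal_pow (norm_nonneg _), ofReal_norm]
    simp
  · intro n hn
    rw [eigenprojection_thermalState b hV, b.orthonormal.2 hn.symm]
    simp

theorem relativeEntropyTerm_nonneg {p q : ℝ} (hp : 0 ≤ p) (hq : 0 < q) :
    0 ≤ p * Real.log p - p * Real.log q + q - p := by
  rcases hp.eq_or_lt with rfl | hp
  · simpa using hq.le
  have h := Real.log_le_sub_one_of_pos (div_pos hq hp)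
  rw [Real.log_div hq.ne' hp.ne'] at h
  have h1 := mul_le_mul_of_nonneg_left h hp.le
  have h2 : p * (q / p - 1) = q - p := by field_simp
  linarith

theorem inner_cfc_negMulLog_nonneg {ρ : H →L[ℂ] H} (hρ : ρ.IsPositive) (hn : ‖ρ‖ ≤ 1) (ψ : H) :
    0 ≤ (inner ℂ ψ (cfc Real.negMulLog ρ ψ)).re := by
  have h : 0 ≤ cfc Real.negMulLog ρ := cfc_nonneg fun x hx => by
    have := spectrum_subset_Icc hρ hn hx
    exact Real.negMulLog_nonneg this.1 this.2
  exact ((ContinuousLinearMap.nonneg_iff_isPositive _).mp h).re_inner_nonneg_right ψ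

/-- The relative entropy to the thermal state, as a sum over photon numbers of nonnegative terms.
The eigenvalues of `τ` are simple, so `tr(P_p Q_q)` reduces to `‖P_p|k⟩‖²`, and the sum over the
eigenvalues `p` of `ρ` can be carried out inside each term. -/
theorem relativeEntropy_thermalState (b : HilbertBasis ℕ ℂ H) {V : ℝ≥0} (hV : 0 < V)
    {ρ : H →L[ℂ] H} (hρ : ρ.IsPositive) (hn : ‖ρ‖ ≤ 1) (hfin : FiniteDimensional ℂ ρ.range) :
    (∀ k, 0 ≤ -(inner ℂ (b k) (cfc Real.negMulLog ρ (b k))).re -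
        (inner ℂ (b k) (ρ (b k))).re * Real.log (thermalWeight V k) +
        thermalWeight V k - (inner ℂ (b k) (ρ (b k))).re) ∧
    relativeEntropy b ρ (thermalState b V) = ∑' k, ENNReal.ofReal
      (-(inner ℂ (b k) (cfc Real.negMulLog ρ (b k))).re -
        (inner ℂ (b k) (ρ (b k))).re * Real.log (thermalWeight V k) +
        thermalWeight V k - (inner ℂ (b k) (ρ (b k))).re) := by
  set F := (finite_setOf_eigenprojection_ne_zero hfin).toFinset with hFdef
  have hF : ∀ p, eigenprojection ρ p ≠ 0 → p ∈ F := fun p hp => by simpa [hFdef] using hp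
  have hF' : ∀ p, p ∉ F → eigenprojection ρ p = 0 := fun p hp => by
    by_contra h
    exact hp (hF p h)
  set t : ℝ≥0 → ℕ → ℝ := fun p k => p * Real.log p - p * Real.log (thermalWeight V k) +
    thermalWeight V k - p with ht
  have ht0 : ∀ p k, 0 ≤ t p k := fun p k =>
    relativeEntropyTerm_nonneg p.2 (thermalWeight_pos hV k)
  have hd : ∀ k, ∑ p ∈ F, ‖eigenprojection ρ p (b k)‖ ^ 2 * t p k =
      -(inner ℂ (b k) (cfc Real.negMulLog ρ (b k))).re -
        (inner ℂ (b k) (ρ (b k))).re * Real.log (thermalWeight V k) +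
        thermalWeight V k - (inner ℂ (b k) (ρ (b k))).re := by
    intro k
    have h1 := sum_mul_norm_eigenprojection_sq hρ hn hfin hF
      (Real.continuous_negMulLog.continuousOn) (b k)
    have h2 := sum_mul_norm_eigenprojection_sq hρ hn hfin hF (f := fun x => x)
      continuousOn_id (b k)
    have h3 := sum_mul_norm_eigenprojection_sq hρ hn hfin hF (f := fun _ => 1)
      continuousOn_const (b k)
    have hsa : IsSelfAdjoint ρ := hρ.isSelfAdjoint
    rw [cfc_id' ℝ ρ hsa] at h2
    rw [cfc_const_one ℝ ρ hsa, one_apply_eq_self, inner_self_eq_norm_sq_to_K,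
      b.orthonormal.1 k] at h3
    have h3' : ∑ p ∈ F, 1 * ‖eigenprojection ρ p (b k)‖ ^ 2 = 1 := by simpa using h3
    rw [← h1, ← h2]
    calc _ = ∑ p ∈ F, (-(Real.negMulLog p * ‖eigenprojection ρ p (b k)‖ ^ 2) -
        p * ‖eigenprojection ρ p (b k)‖ ^ 2 * Real.log (thermalWeight V k) +
        (1 * ‖eigenprojection ρ p (b k)‖ ^ 2) * thermalWeight V k -
        p * ‖eigenprojection ρ p (b k)‖ ^ 2) := by
          refine Finset.sum_congr rfl fun p _ => ?_
          simp only [ht, Real.negMulLog]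
          ring
      _ = _ := by
          rw [Finset.sum_sub_distrib, Finset.sum_add_distrib, Finset.sum_sub_distrib,
            Finset.sum_neg_distrib, ← Finset.sum_mul, ← Finset.sum_mul, h3', one_mul]
  refine ⟨fun k => hd k ▸ Finset.sum_nonneg fun p _ => mul_nonneg (by positivity) (ht0 p k), ?_⟩
  have hq : ∀ p, ∑' q : ℝ≥0, eigenOverlap b ρ (thermalState b V) p q * relativeEntropyTerm p q =
      ∑' k, ENNReal.ofReal (‖eigenprojection ρ p (b k)‖ ^ 2 * t p k) := by
    intro p
    rw [← (thermalWeight_injective hV).tsum_eq]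
    · refine tsum_congr fun k => ?_
      rw [eigenOverlap_thermalState b hV, relativeEntropyTerm,
        if_neg fun h => (thermalWeight_pos hV k).ne' h.1, ENNReal.ofReal_mul (by positivity)]
    · intro q hq
      by_contra h
      refine hq ?_
      simp [eigenOverlap, eigenprojection_thermalState_eq_zero b h]
  rw [relativeEntropy]
  simp_rw [hq]
  rw [tsum_eq_sum (s := F) fun p hp => by simp [hF' p hp],
    ← Summable.tsum_finsetSum fun _ _ => ENNReal.summable]
  refine tsum_congr fun k => ?_
  rw [← hd, ENNReal.ofReal_sum_of_nonneg fun p _ => mul_nonneg (by positivity) (ht0 p k)]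

omit [CompleteSpace H] in
/-- `-tr(ρ log τ)` for the thermal state `τ` depends on `ρ` only through the mean photon number. -/
theorem hasSum_diagonal_mul_log (b : HilbertBasis ℕ ℂ H) {V : ℝ≥0} (hV : 0 < V)
    {ρ : H →L[ℂ] H} (hρ : HasThermalMoments b ρ V) :
    HasSum (fun k => -((inner ℂ (b k) (ρ (b k))).re * Real.log (thermalWeight V k)))
      (Real.log (1 + V) - V * Real.log ((V : ℝ) / (1 + V))) := by
  have h := (hρ.hasSum_diagonal.mul_right (Real.log (1 + V))).sub
    (hρ.hasSum_nat_mul_diagonal.mul_right (Real.log ((V : ℝ) / (1 + V))))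
  rw [one_mul] at h
  refine h.congr_fun fun k => ?_
  rw [log_thermalWeight hV]
  ring

theorem inner_cfc_thermalState (b : HilbertBasis ℕ ℂ H) (V : ℝ≥0) (k : ℕ) :
    (inner ℂ (b k) (cfc Real.negMulLog (thermalState b V) (b k))).re =
      Real.negMulLog (thermalWeight V k) := by
  rw [cfc_apply_of_eigenvector (isPositive_thermalState b V) (norm_thermalState_le b V)
    ⟨NNReal.coe_nonneg _, thermalWeight_le_one V k⟩ (thermalState_apply_basis b V k)
    Real.continuous_negMulLog.continuousOn, inner_smul_right, inner_self_eq_norm_sq_to_K,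
    b.orthonormal.1 k]
  simp

theorem vonNeumannEntropy_thermalState (b : HilbertBasis ℕ ℂ H) {V : ℝ≥0} (hV : 0 < V) :
    vonNeumannEntropy b (thermalState b V) =
      ENNReal.ofReal (Real.log (1 + V) - V * Real.log ((V : ℝ) / (1 + V))) := by
  have h := hasSum_diagonal_mul_log b hV (hasThermalMoments_thermalState b V)
  have h1 : ∀ k, -((inner ℂ (b k) (thermalState b V (b k))).re *
      Real.log (thermalWeight V k)) = Real.negMulLog (thermalWeight V k) := by
    intro k
    rw [inner_basis_thermalState, inner_self_eq_norm_sq_to_K, b.orthonormal.1 k]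
    simp [Real.negMulLog]
  simp_rw [h1] at h
  rw [← h.tsum_eq, ENNReal.ofReal_tsum_of_nonneg (fun k => Real.negMulLog_nonneg
    (NNReal.coe_nonneg _) (thermalWeight_le_one V k)) h.summable, vonNeumannEntropy]
  simp_rw [inner_cfc_thermalState]

theorem relativeEntropy_add_vonNeumannEntropy (b : HilbertBasis ℕ ℂ H) {V : ℝ≥0} (hV : 0 < V)
    {ρ : H →L[ℂ] H} (hρ : ρ.IsPositive) (hn : ‖ρ‖ ≤ 1) (hfin : FiniteDimensional ℂ ρ.range)
    (hm : HasThermalMoments b ρ V) :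
    relativeEntropy b ρ (thermalState b V) + vonNeumannEntropy b ρ =
      vonNeumannEntropy b (thermalState b V) := by
  obtain ⟨hd, hrel⟩ := relativeEntropy_thermalState b hV hρ hn hfin
  have h := ((hasSum_diagonal_mul_log b hV hm).add (hasSum_thermalWeight V)).sub hm.hasSum_diagonal
  rw [add_sub_cancel_right] at h
  rw [hrel, vonNeumannEntropy, ← ENNReal.tsum_add, vonNeumannEntropy_thermalState b hV,
    ← h.tsum_eq]
  have he := fun k => inner_cfc_negMulLog_nonneg hρ hn (b k)
  rw [ENNReal.ofReal_tsum_of_nonneg (fun k => by linarith [hd k, he k]) h.summable]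
  refine tsum_congr fun k => ?_
  rw [← ENNReal.ofReal_add (hd k) (he k)]
  congr 1
  ring

end Spectral

section Limit

variable {H : Type*} [NormedAddCommGroup H] [InnerProductSpace ℂ H] [CompleteSpace H]

/-! ### From weak convergence to convergence of the relative entropy -/

/-- The Cauchy–Schwarz inequality for the form `⟨ψ, ρφ⟩`. -/
theorem norm_inner_apply_sq_le {ρ : H →L[ℂ] H} (hρ : ρ.IsPositive) (ψ φ : H) :
    ‖inner ℂ ψ (ρ φ)‖ ^ 2 ≤ (inner ℂ ψ (ρ ψ)).re * (inner ℂ φ (ρ φ)).re := by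
  obtain ⟨R, hRsa, hR⟩ := exists_sqrt_of_isPositive hρ
  have h1 : ∀ ψ φ, inner ℂ ψ (ρ φ) = inner ℂ (R ψ) (R φ) := by
    intro ψ φ
    rw [← hR, ← ContinuousLinearMap.adjoint_inner_left, hRsa]
  have h2 : ∀ ψ, (inner ℂ (R ψ) (R ψ)).re = ‖R ψ‖ ^ 2 := by
    intro ψ
    rw [inner_self_eq_norm_sq_to_K]
    norm_cast
  rw [h1, h1, h1, h2, h2, ← mul_pow]
  exact pow_le_pow_left₀ (norm_nonneg _) (norm_inner_le_norm _ _) 2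

/-- The distance of `|k⟩` from being an eigenvector of `ρ` is controlled by finitely many matrix
elements, since `|⟨m|ρ|k⟩|² ≤ ⟨m|ρ|m⟩` and the energy bounds the tail of the diagonal. -/
theorem norm_apply_basis_sub_sq_le (b : HilbertBasis ℕ ℂ H) {V : ℝ} {ρ : H →L[ℂ] H}
    (hρ : ρ.IsPositive) (hm : HasThermalMoments b ρ V) {k N : ℕ} (hk : k < N)
    (c : ℂ) :
    ‖ρ (b k) - c • b k‖ ^ 2 ≤
      ∑ m ∈ Finset.range N, ‖inner ℂ (b m) (ρ (b k)) - inner ℂ (b m) (c • b k)‖ ^ 2 + V / N := by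
  have hN : (0 : ℝ) < N := by exact_mod_cast (Nat.zero_le k).trans_lt hk
  set a : ℕ → ℝ := fun m => ‖inner ℂ (b m) (ρ (b k)) - inner ℂ (b m) (c • b k)‖ ^ 2 with ha
  have h1 : HasSum a (‖ρ (b k) - c • b k‖ ^ 2) := by
    simpa only [ha, inner_sub_right] using hasSum_norm_inner_sq b (ρ (b k) - c • b k)
  have h2 : HasSum (fun m => if m ∈ Finset.range N then a m else 0)
      (∑ m ∈ Finset.range N, a m) := by
    have h : HasSum (fun m => if m ∈ Finset.range N then a m else 0)
        (∑ m ∈ Finset.range N, if m ∈ Finset.range N then a m else 0) :=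
      hasSum_sum_of_ne_finset_zero fun m hm => if_neg hm
    rwa [Finset.sum_congr rfl fun m hm => if_pos hm] at h
  -- For `m ≥ N` the term is at most `⟨m|ρ|m⟩ ≤ (m / N) ⟨m|ρ|m⟩`, which sums to at most `V / N`.
  have h3 := h2.add (hm.hasSum_nat_mul_diagonal.div_const (N : ℝ))
  have hr : ∀ m, 0 ≤ (inner ℂ (b m) (ρ (b m))).re := fun m => hρ.re_inner_nonneg_right (b m)
  have hrk : (inner ℂ (b k) (ρ (b k))).re ≤ 1 :=
    le_hasSum hm.hasSum_diagonal k fun m _ => hr m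
  refine hasSum_le (fun m => ?_) h1 h3
  by_cases hmN : m ∈ Finset.range N
  · rw [if_pos hmN]
    have := hr m
    exact le_add_of_nonneg_right (by positivity)
  · rw [if_neg hmN, zero_add]
    rw [Finset.mem_range, not_lt] at hmN
    have h4 : inner ℂ (b m) (c • b k) = 0 := by
      rw [inner_smul_right, b.orthonormal.2 (by omega), mul_zero]
    simp only [ha]
    rw [h4, sub_zero, le_div_iff₀ hN]
    have h5 := norm_inner_apply_sq_le hρ (b m) (b k)
    have h6 : (N : ℝ) ≤ m := by exact_mod_cast hmN
    have h7 : ‖inner ℂ (b m) (ρ (b k))‖ ^ 2 ≤ (inner ℂ (b m) (ρ (b m))).re :=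
      h5.trans (mul_le_of_le_one_right (hr m) hrk)
    rw [mul_comm]
    exact mul_le_mul h6 h7 (by positivity) (by positivity)

variable {ι : Type*} {l : Filter ι}

/-- Weak convergence to the thermal state at bounded energy makes every number state an asymptotic
eigenvector. -/
theorem tendsto_apply_basis (b : HilbertBasis ℕ ℂ H) {V : ℝ≥0} {ρ : ι → H →L[ℂ] H}
    (hρ : ∀ i, (ρ i).IsPositive) (hm : ∀ i, HasThermalMoments b (ρ i) V)
    (hw : ∀ m k, Tendsto (fun i => inner ℂ (b m) (ρ i (b k))) l
      (𝓝 (inner ℂ (b m) (thermalState b V (b k))))) (k : ℕ) :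
    Tendsto (fun i => ρ i (b k)) l (𝓝 (((thermalWeight V k : ℝ) : ℂ) • b k)) := by
  set c : ℂ := ((thermalWeight V k : ℝ) : ℂ) with hc
  have hsq : Tendsto (fun i => ‖ρ i (b k) - c • b k‖ ^ 2) l (𝓝 0) := by
    rw [tendsto_order]
    refine ⟨fun x hx => Eventually.of_forall fun i => hx.trans_le (by positivity), fun ε hε => ?_⟩
    have hVN : Tendsto (fun N : ℕ => (V : ℝ) / N) atTop (𝓝 0) :=
      tendsto_const_div_atTop_nhds_zero_nat _
    obtain ⟨N, hN, hkN⟩ := ((hVN.eventually_lt_const (half_pos hε)).and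
      (eventually_gt_atTop k)).exists
    have hfin : Tendsto (fun i => ∑ m ∈ Finset.range N,
        ‖inner ℂ (b m) (ρ i (b k)) - inner ℂ (b m) (c • b k)‖ ^ 2) l (𝓝 0) := by
      rw [← Finset.sum_const_zero (s := Finset.range N)]
      refine tendsto_finsetSum _ fun m _ => ?_
      have h := ((hw m k).sub_const (inner ℂ (b m) (c • b k))).norm.pow 2
      rwa [thermalState_apply_basis, sub_self, norm_zero, zero_pow two_ne_zero] at h
    filter_upwards [hfin.eventually_lt_const (half_pos hε)] with i hi
    have := norm_apply_basis_sub_sq_le b (hρ i) (hm i) hkN c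
    linarith
  rw [tendsto_iff_norm_sub_tendsto_zero]
  have h := (Real.continuous_sqrt.tendsto 0).comp hsq
  rw [Real.sqrt_zero] at h
  exact h.congr fun i => Real.sqrt_sq (norm_nonneg _)

/-- Since `S(ρ‖τ) + S(ρ) = S(τ)`, convergence to zero of the relative entropy is lower
semicontinuity of the entropy, which holds because each diagonal element of `η(ρ)` converges. -/
theorem tendsto_relativeEntropy_thermalState (b : HilbertBasis ℕ ℂ H) {V : ℝ≥0} (hV : 0 < V)
    {ρ : ι → H →L[ℂ] H} (hρ : ∀ i, (ρ i).IsPositive) (hn : ∀ i, ‖ρ i‖ ≤ 1)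
    (hfin : ∀ i, FiniteDimensional ℂ (ρ i).range) (hm : ∀ i, HasThermalMoments b (ρ i) V)
    (hw : ∀ m k, Tendsto (fun i => inner ℂ (b m) (ρ i (b k))) l
      (𝓝 (inner ℂ (b m) (thermalState b V (b k))))) :
    Tendsto (fun i => relativeEntropy b (ρ i) (thermalState b V)) l (𝓝 0) := by
  set S := vonNeumannEntropy b (thermalState b V) with hS
  have hStop : S ≠ ∞ := by
    rw [hS, vonNeumannEntropy_thermalState b hV]
    exact ENNReal.ofReal_ne_top
  set e : (H →L[ℂ] H) → ℕ → ℝ≥0∞ := fun σ k =>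
    ENNReal.ofReal (inner ℂ (b k) (cfc Real.negMulLog σ (b k))).re with he
  have hek : ∀ k, Tendsto (fun i => e (ρ i) k) l (𝓝 (e (thermalState b V) k)) := by
    intro k
    have h := tendsto_cfc_apply hρ hn ⟨NNReal.coe_nonneg _, thermalWeight_le_one V k⟩
      (tendsto_apply_basis b hρ hm hw k) Real.continuous_negMulLog.continuousOn
    rw [← cfc_apply_of_eigenvector (isPositive_thermalState b V) (norm_thermalState_le b V)
      ⟨NNReal.coe_nonneg _, thermalWeight_le_one V k⟩ (thermalState_apply_basis b V k)
      Real.continuous_negMulLog.continuousOn] at h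
    exact ENNReal.tendsto_ofReal
      ((Complex.continuous_re.tendsto _).comp (tendsto_const_nhds.inner h))
  -- Keeping only `K` terms of `S(ρᵢ)` leaves an upper bound that passes to the limit in `i`.
  have hle : ∀ i K, relativeEntropy b (ρ i) (thermalState b V) ≤
      S - ∑ k ∈ Finset.range K, e (ρ i) k := by
    intro i K
    have h := relativeEntropy_add_vonNeumannEntropy b hV (hρ i) (hn i) (hfin i) (hm i)
    have h1 : ∑ k ∈ Finset.range K, e (ρ i) k ≤ vonNeumannEntropy b (ρ i) :=
      ENNReal.sum_le_tsum _
    refine ENNReal.le_sub_of_add_le_right (ne_top_of_le_ne_top hStop ?_) ?_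
    · exact h1.trans (le_add_self.trans h.le)
    · exact (add_le_add_right h1 _).trans h.le
  rw [ENNReal.tendsto_nhds_zero]
  intro ε hε
  have hK : Tendsto (fun K => S - ∑ k ∈ Finset.range K, e (thermalState b V) k) atTop (𝓝 0) := by
    have h := ENNReal.Tendsto.sub (tendsto_const_nhds (x := S))
      (ENNReal.tendsto_nat_tsum (e (thermalState b V))) (Or.inl hStop)
    rwa [show ∑' k, e (thermalState b V) k = S from rfl, tsub_self] at h
  obtain ⟨K, hK⟩ := (hK.eventually_lt_const hε).exists
  have hi := ENNReal.Tendsto.sub (tendsto_const_nhds (x := S))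
    (tendsto_finsetSum (Finset.range K) fun k _ => hek k) (Or.inl hStop)
  filter_upwards [hi.eventually_lt_const hK] with i h
  exact (hle i K).trans h.le

end Limit

/-! ### Constellations -/

section Constellation

variable {H : Type*} [NormedAddCommGroup H] [InnerProductSpace ℂ H]

theorem isPositive_constellationState (b : HilbertBasis ℕ ℂ H) {Ω : Type*} [MeasurableSpace Ω]
    (P : Measure Ω) (X : Ω → ℂ) (𝒳 : Finset ℂ) : (constellationState b P X 𝒳).IsPositive := by
  refine ContinuousLinearMap.isPositive_sum _ fun x _ => ?_
  refine (InnerProductSpace.isPositive_rankOne_self _).smul_of_nonneg ?_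
  exact_mod_cast measureReal_nonneg

theorem finiteDimensional_range_constellationState (b : HilbertBasis ℕ ℂ H) {Ω : Type*}
    [MeasurableSpace Ω] (P : Measure Ω) (X : Ω → ℂ) (𝒳 : Finset ℂ) :
    FiniteDimensional ℂ (constellationState b P X 𝒳).range := by
  have h : FiniteDimensional ℂ (Submodule.span ℂ (coherent b '' (𝒳 : Set ℂ))) :=
    FiniteDimensional.span_of_finite ℂ (𝒳.finite_toSet.image _)
  refine Submodule.finiteDimensional_of_le (S₂ := Submodule.span ℂ (coherent b '' (𝒳 : Set ℂ))) ?_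
  rintro _ ⟨ψ, rfl⟩
  simp only [constellationState, ContinuousLinearMap.coe_coe, sum_apply, smul_apply,
    InnerProductSpace.rankOne_apply]
  exact Submodule.sum_mem _ fun x hx => Submodule.smul_mem _ _ (Submodule.smul_mem _ _
    (Submodule.subset_span ⟨x, hx, rfl⟩))

variable {Ω : Type*} [MeasurableSpace Ω] {P : Measure Ω} [IsProbabilityMeasure P] {X : Ω → ℂ}
  {𝒳 : Finset ℂ}

/-- The expectation of a function of a finitely supported random variable. -/
theorem sum_measureReal_mul (hX : AEMeasurable X P) (h𝒳 : ∀ᵐ ω ∂P, X ω ∈ 𝒳) (f : ℂ → ℂ) :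
    ∑ x ∈ 𝒳, (P.real {ω | X ω = x} : ℂ) * f x = ∫ ω, f (X ω) ∂P := by
  have hms : ∀ x, NullMeasurableSet {ω | X ω = x} P := fun x =>
    hX.nullMeasurableSet_preimage (measurableSet_singleton x)
  have h1 : (fun ω => f (X ω)) =ᵐ[P]
      fun ω => ∑ x ∈ 𝒳, {ω | X ω = x}.indicator (fun _ => f x) ω := by
    filter_upwards [h𝒳] with ω hω
    rw [Finset.sum_eq_single_of_mem (X ω) hω]
    · simp
    · intro x _ hx
      simp [hx.symm]
  rw [integral_congr_ae h1, integral_finsetSum]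
  · refine Finset.sum_congr rfl fun x _ => ?_
    rw [integral_indicator₀ (hms x), setIntegral_const, Complex.real_smul]
  · intro x _
    exact (integrable_const (f x)).indicator₀ (hms x)

theorem norm_constellationState_le (b : HilbertBasis ℕ ℂ H) (hX : AEMeasurable X P)
    (h𝒳 : ∀ᵐ ω ∂P, X ω ∈ 𝒳) : ‖constellationState b P X 𝒳‖ ≤ 1 := by
  have h1 : ∑ x ∈ 𝒳, P.real {ω | X ω = x} = 1 := by
    have h := sum_measureReal_mul hX h𝒳 fun _ => 1
    simp only [mul_one, integral_const, probReal_univ, one_smul] at h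
    exact_mod_cast h
  rw [← h1]
  refine norm_sum_le_of_le _ fun x _ => ?_
  rw [norm_smul, Complex.norm_real, Real.norm_of_nonneg measureReal_nonneg]
  exact mul_le_of_le_one_right measureReal_nonneg (norm_rankOne_coherent_le b x)

theorem inner_constellationState (b : HilbertBasis ℕ ℂ H) (hX : AEMeasurable X P)
    (h𝒳 : ∀ᵐ ω ∂P, X ω ∈ 𝒳) (ψ φ : H) :
    inner ℂ ψ (constellationState b P X 𝒳 φ) = ∫ ω, inner ℂ ψ
      (InnerProductSpace.rankOne ℂ (coherent b (X ω)) (coherent b (X ω)) φ) ∂P := by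
  rw [← sum_measureReal_mul hX h𝒳 fun x => inner ℂ ψ
    (InnerProductSpace.rankOne ℂ (coherent b x) (coherent b x) φ), constellationState, sum_apply,
    inner_sum]
  exact Finset.sum_congr rfl fun x _ => by rw [smul_apply, inner_smul_right]

theorem hasThermalMoments_constellationState (b : HilbertBasis ℕ ℂ H) (hX : AEMeasurable X P)
    (h𝒳 : ∀ᵐ ω ∂P, X ω ∈ 𝒳) {V : ℝ} (hmean : ∫ ω, X ω ∂P = 0)
    (hvar : ∫ ω, ‖X ω‖ ^ 2 ∂P = V) (hcirc : ∫ ω, X ω ^ 2 ∂P = 0) :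
    HasThermalMoments b (constellationState b P X 𝒳) V := by
  refine hasThermalMoments_constellation b ?_ ?_ ?_ ?_
  · simpa using sum_measureReal_mul hX h𝒳 fun _ => 1
  · rw [sum_measureReal_mul hX h𝒳 fun x => x, hmean]
  · rw [sum_measureReal_mul hX h𝒳 fun x => x ^ 2, hcirc]
  · rw [sum_measureReal_mul hX h𝒳 fun x => (‖x‖ : ℂ) ^ 2, ← hvar, ← integral_complex_ofReal]
    push_cast
    rfl

/-- Convergence in distribution of the constellations gives weak convergence of the states. -/
theorem tendsto_inner_constellationState [CompleteSpace H] (b : HilbertBasis ℕ ℂ H) {V : ℝ≥0}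
    (hV : 0 < V)
    {Ω : ℕ → Type*} [∀ n, MeasurableSpace (Ω n)] {P : ∀ n, Measure (Ω n)}
    [∀ n, IsProbabilityMeasure (P n)] {Ω' : Type*} [MeasurableSpace Ω'] {P' : Measure Ω'}
    [IsProbabilityMeasure P'] {X : ∀ n, Ω n → ℂ} {𝒳 : ℕ → Finset ℂ}
    (h𝒳 : ∀ n, ∀ᵐ ω ∂(P n), X n ω ∈ 𝒳 n) {XG : Ω' → ℂ}
    (hXG : ProbabilityTheory.HasLaw XG (complexGaussian V) P')
    (hconv : TendstoInDistribution X atTop XG P P') (ψ φ : H) :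
    Tendsto (fun n => inner ℂ ψ (constellationState b (P n) (X n) (𝒳 n) φ)) atTop
      (𝓝 (inner ℂ ψ (thermalState b V φ))) := by
  have hc := continuous_inner_rankOne_coherent b ψ φ
  let f : BoundedContinuousFunction ℂ ℂ := BoundedContinuousFunction.ofNormedAddCommGroup
    (fun x => inner ℂ ψ (InnerProductSpace.rankOne ℂ (coherent b x) (coherent b x) φ)) hc
    (‖ψ‖ * ‖φ‖) fun x => norm_inner_map_le (norm_rankOne_coherent_le b x) ψ φ
  have h := (ProbabilityMeasure.tendsto_iff_forall_integral_rclike_tendsto ℂ).mp hconv.tendsto f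
  have h1 : ∫ x, f x ∂(P'.map XG) = inner ℂ ψ (thermalState b V φ) := by
    rw [hXG.map_eq]
    exact integral_inner_rankOne_coherent b hV ψ φ
  have h2 : ∀ n, ∫ x, f x ∂((P n).map (X n)) =
      inner ℂ ψ (constellationState b (P n) (X n) (𝒳 n) φ) := by
    intro n
    rw [integral_map (hconv.forall_aemeasurable n) f.continuous.aestronglyMeasurable,
      inner_constellationState b (hconv.forall_aemeasurable n) (h𝒳 n)]
    rfl
  simp only [ProbabilityMeasure.coe_mk, h1, h2] at h
  exact h

end Constellation

end CVQKD

end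

theorem mainTheorem3
    {H : Type*} [NormedAddCommGroup H] [InnerProductSpace ℂ H] [CompleteSpace H]
    (b : HilbertBasis ℕ ℂ H)
    {Ω : ℕ → Type*} [∀ n, MeasurableSpace (Ω n)] (P : ∀ n, Measure (Ω n))
    [∀ n, IsProbabilityMeasure (P n)]
    {Ω' : Type*} [MeasurableSpace Ω'] (P' : Measure Ω') [IsProbabilityMeasure P']
    (V : ℝ≥0) (hV : 0 < V)
    (X : ∀ n, Ω n → ℂ) (𝒳 : ℕ → Finset ℂ)
    (h𝒳 : ∀ n, ∀ᵐ ω ∂(P n), X n ω ∈ 𝒳 n)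
    (hmean : ∀ n, ∫ ω, X n ω ∂(P n) = 0)
    (hvar : ∀ n, ∫ ω, ‖X n ω‖ ^ 2 ∂(P n) = V)
    (hcirc : ∀ n, ∫ ω, X n ω ^ 2 ∂(P n) = 0)
    (XG : Ω' → ℂ) (hXG : ProbabilityTheory.HasLaw XG (CVQKD.complexGaussian V) P')
    (hconv : TendstoInDistribution X atTop XG P P') :
    (∀ n, ∃! τ, CVQKD.IsGaussianEquivalent b (CVQKD.constellationState b (P n) (X n) (𝒳 n)) τ) ∧
    (∀ n, CVQKD.vonNeumannEntropy b
        (CVQKD.gaussianEquivalent b (CVQKD.constellationState b (P n) (X n) (𝒳 n))) ≠ ∞ ∧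
      CVQKD.nonGaussianity b (CVQKD.constellationState b (P n) (X n) (𝒳 n)) +
          CVQKD.vonNeumannEntropy b (CVQKD.constellationState b (P n) (X n) (𝒳 n)) =
        CVQKD.vonNeumannEntropy b
          (CVQKD.gaussianEquivalent b (CVQKD.constellationState b (P n) (X n) (𝒳 n)))) ∧
    Tendsto (fun n => CVQKD.nonGaussianity b (CVQKD.constellationState b (P n) (X n) (𝒳 n)))
      atTop (𝓝 0) := by

  have hX := hconv.forall_aemeasurable
  have hm := fun n => CVQKD.hasThermalMoments_constellationState b (hX n) (h𝒳 n) (hmean n)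
    (hvar n) (hcirc n)
  have hG := fun n => CVQKD.gaussianEquivalent_eq_thermalState hV (hm n)
  have hpos := fun n => CVQKD.isPositive_constellationState b (P n) (X n) (𝒳 n)
  have hn := fun n => CVQKD.norm_constellationState_le b (hX n) (h𝒳 n)
  have hfin := fun n => CVQKD.finiteDimensional_range_constellationState b (P n) (X n) (𝒳 n)
  simp only [CVQKD.nonGaussianity, hG]
  refine ⟨fun n => CVQKD.existsUnique_isGaussianEquivalent hV (hm n), fun n => ⟨?_, ?_⟩, ?_⟩
  · rw [CVQKD.vonNeumannEntropy_thermalState b hV]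
    exact ENNReal.ofReal_ne_top
  · exact CVQKD.relativeEntropy_add_vonNeumannEntropy b hV (hpos n) (hn n) (hfin n) (hm n)
  · exact CVQKD.tendsto_relativeEntropy_thermalState b hV hpos hn hfin hm fun m k =>
      CVQKD.tendsto_inner_constellationState b hV h𝒳 hXG hconv (b m) (b k)
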